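/- Let $X$ be a set. Let $(X\cup X^{-1})^*$ be the free monoid with involution on $X$, let $\operatorname{red}(w)$ be the freely reduced form of a word $w$, and let $\operatorname{FIM}(X)$ be the free inverse monoid on $X$. An inverse monoid is $F$-inverse if every class of its least group congruence $\sigma$ has a greatest element for the natural partial order; $F$-inverse monoids form a variety in the signature $(\cdot,1,{}^{-1},{}^{\mathfrak m})$, where $s^{\mathfrak m}$ is the greatest element of the $\sigma$-class of $s$. For a relation $R$ on the set $\mathbb I\mathfrak m_X$ of formal terms $u_0v_1^{\mathfrak m}u_1\cdots v_n^{\mathfrak m}u_n$ ($u_i,v_i\in (X\cup X^{-1})^*$), $\operatorname{FInv}\langle X\mid R\rangle$ denotes the quotient of the free $F$-inverse monoid on $X$ by the congruence generated by $R$. Let $\Gamma_X$ be the Cayley graph of the free group $F(X)$ on $X$: its vertices are the elements of $F(X)$, and for each vertex $g$ and each $a\in X\cup X^{-1}$ there is an edge labelled $a$ from $g$ to $ga$, whose inverse edge is the one labelled $a^{-1}$ from $ga$ to $g$. A subgraph is a set of vertices and edges closed under taking endpoints and inverse edges; it is connected if any two of its vertices are joined by a path in it (so the empty subgraph is connected).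 A term $u_0v_1^{\mathfrak m}u_1\cdots v_n^{\mathfrak m}u_n$ labels a journey from $g$ to $h$ in a subgraph $\Delta$ if, starting at $g$, following alternately the paths labelled $u_i$ and the jumps from a vertex $k$ to the vertex $kv_i$, one stays in $\Delta$ and ends at $h$. Given a relation $R$ on $\mathbb I\mathfrak m_X$ whose related terms are equal in $F(X)$, a subgraph $\Delta$ is $c_R$-closed if for all $(p,q)\in R$ and all vertices $g,h$ of $\Delta$, $p$ labels a journey from $g$ to $h$ in $\Delta$ if and only if $q$ does; $\Delta^{c_R}$ is the least $c_R$-closed subgraph containing $\Delta$. Let $S_{c_R}$ be the set of pairs $(\Delta,g)$ where $g \in F(X)$ and $\Delta$ is the $c_R$-closure of a finite subgraph and contains the vertices $1$ and $g$, with the operations $(\Delta,g)(\Xi,h)=((\Delta\cup g\Xi)^{c_R},gh)$, $(\Delta,g)^{-1}=(g^{-1}\Delta,g^{-1})$, $(\Delta,g)^{\mathfrak m}=(\{1,g\}^{c_R},g)$ and identity $(\{1\}^{c_R},1)$. **Proposition.** Let $R$ be the set of relations $\operatorname{red}(w)=w^{\mathfrak m}$, $w\in (X\cup X^{-1})^*$,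 and let $S=\operatorname{FInv}\langle X\mid \operatorname{red}(w)=w^{\mathfrak m},\ w\in (X\cup X^{-1})^*\rangle$. 1. $\operatorname{FIM}(X)$ is $F$-inverse, with $(w_{\operatorname{FIM}(X)})^{\mathfrak m}=\operatorname{red}(w)_{\operatorname{FIM}(X)}$ for every $w\in (X\cup X^{-1})^*$, and there is an isomorphism of $F$-inverse monoids $S\cong\operatorname{FIM}(X)$ that respects the generators $X$; that is, $\operatorname{FIM}(X)$ is presented as an $F$-inverse monoid by $\operatorname{FInv}\langle X\mid \operatorname{red}(w)=w^{\mathfrak m},\ w\in (X\cup X^{-1})^*\rangle$. 2. The greatest group image $S/\sigma$ is the free group on $X$, by an isomorphism respecting the generators. 3. The $c_R$-closed subgraphs of $\Gamma_X$ are exactly the connected subgraphs. 4. $S_{c_R}$ is Munn's model: it consists exactly of the pairs $(\Delta,g)$ with $\Delta$ a finite connected subgraph of $\Gamma_X$ containing $1$ and $g$, and $(\Delta,g)(\Xi,h)=(\Delta\cup g\Xi,gh)$ in it. There is an isomorphism of inverse monoids $\operatorname{FIM}(X)\cong S_{c_R}$ mapping the element represented by each word $w$ to $(\langle\overline w\rangle,w_{F(X)})$,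 where $\langle\overline w\rangle$ is the subgraph spanned by the path labelled $w$ starting at $1$. There is also an isomorphism $S\cong S_{c_R}$ preserving all the operations, including ${}^{\mathfrak m}$, and mapping each generator $x \in X$ to $(\langle\overline x\rangle^{c_R},x)$. -/

import Mathlib

noncomputable section

universe u v

/-! ## Inverse monoids and F-inverse monoids -/

/-- Inverse monoids, as the variety of monoids with a unary operation in the signature
`(·, 1, ⁻¹)`.  See `InverseMonoid.eq_inv_iff`: `s⁻¹` is the unique inverse of `s`. -/
class InverseMonoid (M : Type*) extends Monoid M, InvolutiveInv M where
  mul_inv_rev' : ∀ a b : M, (a * b)⁻¹ = b⁻¹ * a⁻¹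
  mul_inv_mul' : ∀ a : M, a * a⁻¹ * a = a
  idem_comm' : ∀ a b : M, (a * a⁻¹) * (b * b⁻¹) = (b * b⁻¹) * (a * a⁻¹)

namespace InverseMonoid

variable {M : Type*} [InverseMonoid M]

theorem mul_inv_r (a b : M) : (a * b)⁻¹ = b⁻¹ * a⁻¹ := mul_inv_rev' a b

theorem mul_inv_mul (a : M) : a * (a⁻¹ * a) = a := by
  rw [← mul_assoc]; exact mul_inv_mul' a

theorem inv_mul_inv (a : M) : a⁻¹ * (a * a⁻¹) = a⁻¹ := by
  simpa using mul_inv_mul a⁻¹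

theorem comm_rr (a b : M) : (a * a⁻¹) * (b * b⁻¹) = (b * b⁻¹) * (a * a⁻¹) := idem_comm' a b

theorem inv_one' : (1 : M)⁻¹ = 1 := by
  simpa using mul_inv_mul (1 : M)

theorem idem_inv_eq {e : M} (he : e * e = e) : e⁻¹ = e := by
  have he' : e⁻¹ * e⁻¹ = e⁻¹ := by rw [← mul_inv_r, he]
  have hc := comm_rr e⁻¹ e
  rw [inv_inv] at hc
  calc e⁻¹ = e⁻¹ * e * (e * e⁻¹) := by
        rw [mul_assoc, ← mul_assoc e e, he, inv_mul_inv]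
    _ = e * e⁻¹ * (e⁻¹ * e) := hc
    _ = e := by rw [mul_assoc, ← mul_assoc e⁻¹ e⁻¹, he', mul_inv_mul]

theorem idem_mul_inv {e : M} (he : e * e = e) : e * e⁻¹ = e := by rw [idem_inv_eq he, he]

theorem idem_comm {e f : M} (he : e * e = e) (hf : f * f = f) : e * f = f * e := by
  have := comm_rr e f
  rwa [idem_mul_inv he, idem_mul_inv hf] at this

theorem rr_idem (a : M) : (a * a⁻¹) * (a * a⁻¹) = a * a⁻¹ := by
  rw [mul_assoc, inv_mul_inv]

theorem rr_inv (a : M) : (a * a⁻¹)⁻¹ = a * a⁻¹ := by rw [mul_inv_r, inv_inv]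

/-- `t` is an inverse of `s` in the semigroup sense iff `t = s⁻¹`. -/
theorem eq_inv_iff (s t : M) : (s * t * s = s ∧ t * s * t = t) ↔ t = s⁻¹ := by
  constructor
  · rintro ⟨h1, h2⟩
    have i1 : (s * t) * (s * t) = s * t := by rw [← mul_assoc, h1]
    have i2 : (t * s) * (t * s) = t * s := by rw [← mul_assoc, h2]
    have i3 := rr_idem s
    have i4 : (s⁻¹ * s) * (s⁻¹ * s) = s⁻¹ * s := by simpa using rr_idem s⁻¹
    have c1 := idem_comm i1 i3
    have c2 := idem_comm i2 i4
    calc t = t * s * t := h2.symm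
      _ = t * (s * s⁻¹ * (s * t)) := by
          rw [← mul_assoc (s * s⁻¹), mul_assoc s s⁻¹ s, mul_inv_mul, mul_assoc]
      _ = t * s * t * (s * s⁻¹) := by rw [← c1]; simp only [mul_assoc]
      _ = t * s * s⁻¹ := by rw [h2, mul_assoc]
      _ = t * s * (s⁻¹ * s) * s⁻¹ := by
          rw [mul_assoc (t * s), mul_assoc s⁻¹, inv_mul_inv]
      _ = s⁻¹ * s * t * s * s⁻¹ := by rw [c2]; simp only [mul_assoc]
      _ = s⁻¹ * (s * t * s) * s⁻¹ := by simp only [mul_assoc]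
      _ = s⁻¹ := by rw [h1, mul_assoc, inv_mul_inv]
  · rintro rfl
    exact ⟨mul_inv_mul' s, by rw [mul_assoc, inv_mul_inv]⟩

/-- The natural partial order: `a ≤ b` iff `a = a a⁻¹ b`. -/
def NatLE (a b : M) : Prop := a = a * a⁻¹ * b

/-- The relation `σ`: two elements are related iff they have a common lower bound in the natural
partial order. -/
def Sigma (a b : M) : Prop := ∃ c, NatLE c a ∧ NatLE c b

/-- `m` is the greatest element (for the natural partial order) of the `σ`-class of `s`. -/
def IsSigmaGreatest (s m : M) : Prop := Sigma s m ∧ ∀ t, Sigma s t → NatLE t m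

theorem NatLE.refl (a : M) : NatLE a a := (mul_inv_mul' a).symm

theorem idem_mul_le {e : M} (he : e * e = e) (a : M) : NatLE (e * a) a := by
  unfold NatLE
  have c := idem_comm he (rr_idem a)
  rw [mul_inv_r, idem_inv_eq he]
  calc e * a = e * (e * (a * a⁻¹) * a) := by
        rw [mul_assoc e (a * a⁻¹), mul_inv_mul' a, ← mul_assoc, he]
    _ = e * ((a * a⁻¹) * e * a) := by rw [c]
    _ = _ := by simp only [mul_assoc]

theorem NatLE.trans {a b c : M} (h1 : NatLE a b) (h2 : NatLE b c) : NatLE a c := by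
  unfold NatLE at *
  have : a * a⁻¹ * (b * b⁻¹) * c = a := by
    rw [mul_assoc, ← h2]; exact h1.symm
  have h3 := idem_mul_le (e := a * a⁻¹ * (b * b⁻¹)) (by
    have c := comm_rr a b
    calc a * a⁻¹ * (b * b⁻¹) * (a * a⁻¹ * (b * b⁻¹))
        = a * a⁻¹ * ((b * b⁻¹) * (a * a⁻¹)) * (b * b⁻¹) := by simp only [mul_assoc]
      _ = (a * a⁻¹ * (a * a⁻¹)) * ((b * b⁻¹) * (b * b⁻¹)) := by
          rw [← c]; simp only [mul_assoc]
      _ = _ := by rw [rr_idem, rr_idem]) c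
  rw [this] at h3
  exact h3

theorem NatLE.antisymm {a b : M} (h1 : NatLE a b) (h2 : NatLE b a) : a = b := by
  unfold NatLE at *
  calc a = a * a⁻¹ * (b * b⁻¹ * a) := by rw [← h2]; exact h1
    _ = b * b⁻¹ * (a * a⁻¹) * a := by rw [← comm_rr]; simp only [mul_assoc]
    _ = b := by rw [mul_assoc, mul_inv_mul' a, ← h2]

theorem Sigma.refl (a : M) : Sigma a a := ⟨a, NatLE.refl a, NatLE.refl a⟩

theorem Sigma.symm {a b : M} : Sigma a b → Sigma b a := fun ⟨c, h1, h2⟩ => ⟨c, h2, h1⟩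

theorem Sigma.trans {a b c : M} : Sigma a b → Sigma b c → Sigma a c := by
  rintro ⟨d, d1, d2⟩ ⟨f, f1, f2⟩
  have hd : NatLE (f * f⁻¹ * d) d := idem_mul_le (rr_idem f) d
  have hf : NatLE (f * f⁻¹ * d) f := by
    have : f * f⁻¹ * d = d * d⁻¹ * f := by
      calc f * f⁻¹ * d = f * f⁻¹ * (d * d⁻¹ * b) := by rw [← show d = d * d⁻¹ * b from d2]
        _ = d * d⁻¹ * (f * f⁻¹ * b) := by rw [← mul_assoc, ← mul_assoc (d * d⁻¹), comm_rr]
        _ = d * d⁻¹ * f := by rw [← show f = f * f⁻¹ * b from f1]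
    rw [this]
    exact idem_mul_le (rr_idem d) f
  exact ⟨_, hd.trans d1, hf.trans f2⟩

theorem NatLE.eq_mul_right {a b : M} (h : NatLE a b) : a = b * (a⁻¹ * a) := by
  have ha : a⁻¹ * a = b⁻¹ * (a * a⁻¹) * b := by
    conv_lhs => rw [h]
    rw [mul_inv_r, rr_inv]
    calc b⁻¹ * (a * a⁻¹) * (a * a⁻¹ * b) = b⁻¹ * ((a * a⁻¹) * (a * a⁻¹)) * b := by
          simp only [mul_assoc]
      _ = _ := by rw [rr_idem]
  rw [ha]
  calc a = a * a⁻¹ * b := h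
    _ = a * a⁻¹ * (b * b⁻¹ * b) := by rw [mul_inv_mul' b]
    _ = a * a⁻¹ * (b * b⁻¹) * b := by simp only [mul_assoc]
    _ = b * b⁻¹ * (a * a⁻¹) * b := by rw [comm_rr]
    _ = _ := by simp only [mul_assoc]

theorem mul_idem_le (a : M) {e : M} (he : e * e = e) : NatLE (a * e) a := by
  have c : e * (a⁻¹ * a) = a⁻¹ * a * e := idem_comm he (by simpa using rr_idem a⁻¹)
  unfold NatLE
  rw [mul_inv_r, idem_inv_eq he]
  calc a * e = a * (a⁻¹ * a) * e := by rw [mul_inv_mul]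
    _ = a * (e * e * (a⁻¹ * a)) := by rw [he, c]; simp only [mul_assoc]
    _ = _ := by simp only [mul_assoc]

theorem NatLE.mul {a b c d : M} (h1 : NatLE a b) (h2 : NatLE c d) : NatLE (a * c) (b * d) := by
  have h2' := h2.eq_mul_right
  have hc : (c⁻¹ * c) * (c⁻¹ * c) = c⁻¹ * c := by simpa using rr_idem c⁻¹
  have e1 : a * c = a * a⁻¹ * (b * d * (c⁻¹ * c)) := by
    conv_lhs => rw [h1, h2']
    simp only [mul_assoc]
  rw [e1]
  exact (idem_mul_le (rr_idem a) _).trans (mul_idem_le _ hc)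

theorem NatLE.inv {a b : M} (h : NatLE a b) : NatLE a⁻¹ b⁻¹ := by
  have h' := congrArg (·⁻¹) h
  simp only [mul_inv_r, inv_inv] at h'
  rw [h']
  exact mul_idem_le _ (rr_idem a)

theorem Sigma.inv {a b : M} : Sigma a b → Sigma a⁻¹ b⁻¹ :=
  fun ⟨c, h1, h2⟩ => ⟨c⁻¹, h1.inv, h2.inv⟩

variable (M) in
/-- `σ` as a congruence. -/
def sigmaCon : Con M where
  r := Sigma
  iseqv := ⟨Sigma.refl, Sigma.symm, Sigma.trans⟩
  mul' := fun ⟨c, h1, h2⟩ ⟨d, h3, h4⟩ => ⟨c * d, h1.mul h3, h2.mul h4⟩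

variable (M) in
/-- The greatest group image `M/σ`. -/
def GroupImage : Type _ := (sigmaCon M).Quotient

instance : Group (GroupImage M) :=
  { (inferInstance : Monoid (sigmaCon M).Quotient) with
    inv := Quotient.map' (fun a => a⁻¹) (fun _ _ h => Sigma.inv h)
    inv_mul_cancel := by
      intro x
      induction x using Quotient.inductionOn' with
      | h a =>
        refine Quotient.sound' (s₁ := (sigmaCon M).toSetoid)
          (show Sigma (a⁻¹ * a) 1 from ⟨a⁻¹ * a, NatLE.refl _, ?_⟩)
        have := mul_idem_le (1 : M) (e := a⁻¹ * a) (by simpa using rr_idem a⁻¹)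
        rwa [one_mul] at this }

/-- The natural projection `σ♯ : M → M/σ`. -/
def sigmaMk : M →* GroupImage M := (sigmaCon M).mk'

end InverseMonoid

open InverseMonoid

/-- F-inverse monoids in the signature `(·, 1, ⁻¹, 𝔪)`: inverse monoids in which each `σ`-class has
a greatest element, `maxi s` being the greatest element of the `σ`-class of `s`. -/
class FInverseMonoid (M : Type*) extends InverseMonoid M where
  maxi : M → M
  isSigmaGreatest_maxi : ∀ s : M, IsSigmaGreatest s (maxi s)

namespace FInverseMonoid

theorem le_maxi {M : Type*} [FInverseMonoid M] (a : M) : NatLE a (maxi a) :=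
  (isSigmaGreatest_maxi a).2 a (Sigma.refl a)

theorem maxi_eq_of_sigma {M : Type*} [FInverseMonoid M] {a b : M} (h : Sigma a b) :
    maxi a = maxi b :=
  NatLE.antisymm
    ((isSigmaGreatest_maxi b).2 _ (h.symm.trans (isSigmaGreatest_maxi a).1))
    ((isSigmaGreatest_maxi a).2 _ (h.trans (isSigmaGreatest_maxi b).1))

theorem maxi_idem_mul {M : Type*} [FInverseMonoid M] (a b : M) :
    maxi (b * b⁻¹ * a) = maxi a :=
  maxi_eq_of_sigma ⟨_, NatLE.refl _, idem_mul_le (rr_idem b) a⟩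

/-- F-inverse monoids form a variety: the following two equations suffice. -/
abbrev ofEquations {M : Type*} [InverseMonoid M] (m : M → M)
    (h1 : ∀ a, a = a * a⁻¹ * m a) (h2 : ∀ a b, m (b * b⁻¹ * a) = m a) : FInverseMonoid M where
  maxi := m
  isSigmaGreatest_maxi s := by
    have key : ∀ {a b : M}, NatLE a b → m a = m b := fun {a b} h => by
      have h' : a = a * a⁻¹ * b := h
      rw [h', h2]
    refine ⟨⟨s, NatLE.refl s, h1 s⟩, ?_⟩
    rintro t ⟨c, hs, ht⟩
    rw [← key hs, key ht]
    exact h1 t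

end FInverseMonoid

open FInverseMonoid

/-! ## Words, terms and their values -/

/-- Words over `X ∪ X⁻¹`; the letter `(x, true)` is `x` and `(x, false)` is `x⁻¹`. -/
abbrev InvWord (X : Type u) : Type u := List (X × Bool)

/-- The set `𝕀𝔪_X` of formal expressions `u₀ v₁^𝔪 u₁ ⋯ vₙ^𝔪 uₙ` with `uᵢ, vᵢ` words over
`X ∪ X⁻¹`, as words over the disjoint union of the letters and of the symbols `v^𝔪`. -/
abbrev ImTerm (X : Type u) : Type u := List ((X × Bool) ⊕ InvWord X)

/-- The freely reduced form of a word. -/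
def red {X : Type u} (w : InvWord X) : InvWord X :=
  letI := Classical.decEq X
  FreeGroup.reduce w

/-- A word as a term. -/
def ImTerm.ofWord {X : Type u} (w : InvWord X) : ImTerm X := w.map Sum.inl

/-- The term `w^𝔪` for a word `w`. -/
def ImTerm.maxWord {X : Type u} (w : InvWord X) : ImTerm X := [Sum.inr w]

/-- The value of a letter of `X ∪ X⁻¹`. -/
def letterVal {X : Type u} {M : Type v} [Inv M] (ι : X → M) (a : X × Bool) : M :=
  if a.2 then ι a.1 else (ι a.1)⁻¹

/-- The value `w_S` of a word `w`. -/
def wordVal {X : Type u} {M : Type v} [Monoid M] [Inv M] (ι : X → M) (w : InvWord X) : M :=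
  (w.map (letterVal ι)).prod

/-- The value `w_S` of a term `w`, the operation `𝔪` being interpreted as `m`. -/
def ImTerm.val {X : Type u} {M : Type v} [Monoid M] [Inv M] (m : M → M) (ι : X → M)
    (w : ImTerm X) : M :=
  (w.map (Sum.elim (letterVal ι) (fun v => m (wordVal ι v)))).prod

/-! ## The free inverse monoid -/

/-- The defining relations of the Vagner congruence on the free monoid with involution. -/
inductive VagnerRel (X : Type u) : FreeMonoid (X × Bool) → FreeMonoid (X × Bool) → Prop
  | regular (w : InvWord X) :
      VagnerRel X (.ofList (w ++ FreeGroup.invRev w ++ w)) (.ofList w)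
  | comm (w z : InvWord X) :
      VagnerRel X (.ofList (w ++ FreeGroup.invRev w ++ (z ++ FreeGroup.invRev z)))
        (.ofList (z ++ FreeGroup.invRev z ++ (w ++ FreeGroup.invRev w)))

/-- The free inverse monoid on `X`: the quotient of the free monoid with involution
`(X ∪ X⁻¹)*` by the Vagner congruence. -/
def FreeInverseMonoid (X : Type u) : Type u := (conGen (VagnerRel X)).Quotient

namespace FreeInverseMonoid

variable {X : Type u}

theorem invRev_rel {a b : FreeMonoid (X × Bool)} (h : ConGen.Rel (VagnerRel X) a b) :
    ConGen.Rel (VagnerRel X) (.ofList (FreeGroup.invRev a.toList))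
      (.ofList (FreeGroup.invRev b.toList)) := by
  induction h with
  | of x y h =>
    cases h with
    | regular w =>
      have := ConGen.Rel.of _ _ (VagnerRel.regular (FreeGroup.invRev w))
      simpa [FreeGroup.invRev_append, FreeGroup.invRev_invRev, List.append_assoc] using this
    | comm w z =>
      have := ConGen.Rel.of _ _ (VagnerRel.comm z w)
      simpa [FreeGroup.invRev_append, FreeGroup.invRev_invRev, List.append_assoc] using this
  | refl x => exact .refl _
  | symm _ ih => exact .symm ih
  | trans _ _ ih1 ih2 => exact .trans ih1 ih2
  | mul _ _ ih1 ih2 =>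
    have := ConGen.Rel.mul ih2 ih1
    simpa [FreeMonoid.toList_mul, FreeGroup.invRev_append, FreeMonoid.ofList_append] using this

/-- The class of a word. -/
def mk (w : InvWord X) : FreeInverseMonoid X :=
  Quotient.mk (conGen (VagnerRel X)).toSetoid (FreeMonoid.ofList w)

theorem mk_sound {a b : FreeMonoid (X × Bool)} (h : VagnerRel X a b) :
    mk a.toList = mk b.toList := Quotient.sound (ConGen.Rel.of _ _ h)

theorem ind {p : FreeInverseMonoid X → Prop} (h : ∀ w, p (mk w)) (s : FreeInverseMonoid X) :
    p s := Quotient.inductionOn s h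

instance : Monoid (FreeInverseMonoid X) :=
  inferInstanceAs (Monoid (conGen (VagnerRel X)).Quotient)

instance : Inv (FreeInverseMonoid X) where
  inv := Quotient.map (fun a => FreeMonoid.ofList (FreeGroup.invRev a.toList))
    (fun _ _ h => invRev_rel h)

theorem mk_mul (w z : InvWord X) : mk w * mk z = mk (w ++ z) := rfl

theorem mk_inv (w : InvWord X) : (mk w)⁻¹ = mk (FreeGroup.invRev w) := rfl

instance : InverseMonoid (FreeInverseMonoid X) where
  inv_inv := ind fun w => by rw [mk_inv, mk_inv, FreeGroup.invRev_invRev]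
  mul_inv_rev' := ind fun w => ind fun z => by
    rw [mk_mul, mk_inv, mk_inv, mk_inv, mk_mul, FreeGroup.invRev_append]
  mul_inv_mul' := ind fun w => mk_sound (VagnerRel.regular w)
  idem_comm' := ind fun w => ind fun z => mk_sound (VagnerRel.comm w z)

/-- The generators of the free inverse monoid. -/
def of (x : X) : FreeInverseMonoid X := mk [(x, true)]

end FreeInverseMonoid

/-! ## The free F-inverse monoid and presentations -/

/-- Terms over `X` in the signature `(·, 1, ⁻¹, 𝔪)`. -/
inductive FTerm (X : Type u) : Type u
  | of : X → FTerm X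
  | one : FTerm X
  | mul : FTerm X → FTerm X → FTerm X
  | inv : FTerm X → FTerm X
  | maxi : FTerm X → FTerm X

/-- Equality of terms modulo the identities of F-inverse monoids. -/
inductive FTerm.Rel {X : Type u} : FTerm X → FTerm X → Prop
  | refl (a) : Rel a a
  | symm {a b} : Rel a b → Rel b a
  | trans {a b c} : Rel a b → Rel b c → Rel a c
  | mul_congr {a b c d} : Rel a b → Rel c d → Rel (mul a c) (mul b d)
  | inv_congr {a b} : Rel a b → Rel (inv a) (inv b)
  | maxi_congr {a b} : Rel a b → Rel (maxi a) (maxi b)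
  | mul_assoc (a b c) : Rel (mul (mul a b) c) (mul a (mul b c))
  | one_mul (a) : Rel (mul one a) a
  | mul_one (a) : Rel (mul a one) a
  | inv_inv (a) : Rel (inv (inv a)) a
  | mul_inv_rev (a b) : Rel (inv (mul a b)) (mul (inv b) (inv a))
  | mul_inv_mul (a) : Rel (mul (mul a (inv a)) a) a
  | idem_comm (a b) : Rel (mul (mul a (inv a)) (mul b (inv b)))
      (mul (mul b (inv b)) (mul a (inv a)))
  | le_maxi (a) : Rel a (mul (mul a (inv a)) (maxi a))
  | maxi_idem_mul (a b) : Rel (maxi (mul (mul b (inv b)) a)) (maxi a)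

/-- The setoid of `FTerm.Rel`. -/
def FTerm.setoid (X : Type u) : Setoid (FTerm X) where
  r := FTerm.Rel
  iseqv := ⟨.refl, .symm, .trans⟩

/-- The free F-inverse monoid on `X`. -/
def FreeFInverseMonoid (X : Type u) : Type u := Quotient (FTerm.setoid X)

namespace FreeFInverseMonoid

variable {X : Type u}

instance : InverseMonoid (FreeFInverseMonoid X) where
  mul := Quotient.map₂ FTerm.mul (fun _ _ h1 _ _ h2 => .mul_congr h1 h2)
  one := Quotient.mk _ FTerm.one
  inv := Quotient.map FTerm.inv (fun _ _ h => .inv_congr h)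
  mul_assoc := by rintro ⟨a⟩ ⟨b⟩ ⟨c⟩; exact Quotient.sound (.mul_assoc a b c)
  one_mul := by rintro ⟨a⟩; exact Quotient.sound (.one_mul a)
  mul_one := by rintro ⟨a⟩; exact Quotient.sound (.mul_one a)
  inv_inv := by rintro ⟨a⟩; exact Quotient.sound (.inv_inv a)
  mul_inv_rev' := by rintro ⟨a⟩ ⟨b⟩; exact Quotient.sound (.mul_inv_rev a b)
  mul_inv_mul' := by rintro ⟨a⟩; exact Quotient.sound (.mul_inv_mul a)
  idem_comm' := by rintro ⟨a⟩ ⟨b⟩; exact Quotient.sound (.idem_comm a b)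

instance : FInverseMonoid (FreeFInverseMonoid X) :=
  FInverseMonoid.ofEquations
    (Quotient.map FTerm.maxi (fun _ _ h => .maxi_congr h))
    (by rintro ⟨a⟩; exact Quotient.sound (.le_maxi a))
    (by rintro ⟨a⟩ ⟨b⟩; exact Quotient.sound (.maxi_idem_mul a b))

/-- The generators of the free F-inverse monoid. -/
def of (x : X) : FreeFInverseMonoid X := Quotient.mk _ (FTerm.of x)

/-- The value of a term in an F-inverse monoid. -/
def eval {M : Type v} [FInverseMonoid M] (ι : X → M) : FTerm X → M
  | .of x => ι x
  | .one => 1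
  | .mul a b => eval ι a * eval ι b
  | .inv a => (eval ι a)⁻¹
  | .maxi a => FInverseMonoid.maxi (eval ι a)

theorem eval_rel {M : Type v} [FInverseMonoid M] (ι : X → M) {a b : FTerm X}
    (h : FTerm.Rel a b) : eval ι a = eval ι b := by
  induction h with
  | refl _ => rfl
  | symm _ ih => exact ih.symm
  | trans _ _ ih1 ih2 => exact ih1.trans ih2
  | mul_congr _ _ ih1 ih2 => simp only [eval, ih1, ih2]
  | inv_congr _ ih => simp only [eval, ih]
  | maxi_congr _ ih => simp only [eval, ih]
  | mul_assoc a b c => exact _root_.mul_assoc _ _ _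
  | one_mul a => exact _root_.one_mul _
  | mul_one a => exact _root_.mul_one _
  | inv_inv a => exact _root_.inv_inv _
  | mul_inv_rev a b => exact mul_inv_r _ _
  | mul_inv_mul a => exact InverseMonoid.mul_inv_mul' _
  | idem_comm a b => exact InverseMonoid.idem_comm' _ _
  | le_maxi a => exact FInverseMonoid.le_maxi _
  | maxi_idem_mul a b => exact FInverseMonoid.maxi_idem_mul _ _

/-- `FreeFInverseMonoid X` is free on `X` in the class of F-inverse monoids. -/
theorem existsUnique_lift {M : Type v} [FInverseMonoid M] (ι : X → M) :
    ∃! φ : FreeFInverseMonoid X →* M, (∀ s, φ s⁻¹ = (φ s)⁻¹) ∧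
      (∀ s, φ (maxi s) = maxi (φ s)) ∧ ∀ x, φ (of x) = ι x := by
  refine ⟨{ toFun := Quotient.lift (eval ι) (fun _ _ h => eval_rel ι h), map_one' := rfl,
            map_mul' := by rintro ⟨a⟩ ⟨b⟩; rfl }, ⟨?_, ?_, fun x => rfl⟩, ?_⟩
  · rintro ⟨a⟩; rfl
  · rintro ⟨a⟩; rfl
  · rintro ψ ⟨h1, h2, h3⟩
    ext ⟨a⟩
    change ψ (Quotient.mk _ a) = eval ι a
    induction a with
    | of x => exact h3 x
    | one => exact ψ.map_one
    | mul a b iha ihb => exact (ψ.map_mul _ _).trans (congrArg₂ _ iha ihb)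
    | inv a ih => exact (h1 _).trans (congrArg _ ih)
    | maxi a ih => exact (h2 _).trans (congrArg _ ih)

end FreeFInverseMonoid

/-- The congruence (for the signature `(·, 1, ⁻¹, 𝔪)`) on an F-inverse monoid generated by a
relation. -/
inductive FCongGen {M : Type u} [FInverseMonoid M] (r : M → M → Prop) : M → M → Prop
  | of {a b} : r a b → FCongGen r a b
  | refl (a) : FCongGen r a a
  | symm {a b} : FCongGen r a b → FCongGen r b a
  | trans {a b c} : FCongGen r a b → FCongGen r b c → FCongGen r a c
  | mul {a b c d} : FCongGen r a b → FCongGen r c d → FCongGen r (a * c) (b * d)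
  | inv {a b} : FCongGen r a b → FCongGen r a⁻¹ b⁻¹
  | maxi {a b} : FCongGen r a b → FCongGen r (maxi a) (maxi b)

/-- The setoid of `FCongGen r`. -/
def FCongGen.setoid {M : Type u} [FInverseMonoid M] (r : M → M → Prop) : Setoid M where
  r := FCongGen r
  iseqv := ⟨.refl, .symm, .trans⟩

/-- The quotient of an F-inverse monoid by the congruence generated by a relation. -/
def FQuotient {M : Type u} [FInverseMonoid M] (r : M → M → Prop) : Type u :=
  Quotient (FCongGen.setoid r)

namespace FQuotient

variable {M : Type u} [FInverseMonoid M] (r : M → M → Prop)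

/-- The class of an element. -/
def mk (a : M) : FQuotient r := Quotient.mk _ a

instance : InverseMonoid (FQuotient r) where
  mul := Quotient.map₂ (· * ·) (fun _ _ h1 _ _ h2 => .mul h1 h2)
  one := mk r 1
  inv := Quotient.map (·⁻¹) (fun _ _ h => .inv h)
  mul_assoc := by rintro ⟨a⟩ ⟨b⟩ ⟨c⟩; exact congrArg (mk r) (mul_assoc a b c)
  one_mul := by rintro ⟨a⟩; exact congrArg (mk r) (one_mul a)
  mul_one := by rintro ⟨a⟩; exact congrArg (mk r) (mul_one a)
  inv_inv := by rintro ⟨a⟩; exact congrArg (mk r) (inv_inv a)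
  mul_inv_rev' := by rintro ⟨a⟩ ⟨b⟩; exact congrArg (mk r) (mul_inv_rev' a b)
  mul_inv_mul' := by rintro ⟨a⟩; exact congrArg (mk r) (mul_inv_mul' a)
  idem_comm' := by rintro ⟨a⟩ ⟨b⟩; exact congrArg (mk r) (idem_comm' a b)

instance : FInverseMonoid (FQuotient r) :=
  FInverseMonoid.ofEquations
    (Quotient.map maxi (fun _ _ h => .maxi h))
    (by rintro ⟨a⟩; exact congrArg (mk r) (le_maxi a))
    (by rintro ⟨a⟩ ⟨b⟩; exact congrArg (mk r) (maxi_idem_mul a b))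

end FQuotient

/-- A relation on terms, read in the free F-inverse monoid. -/
def termRel {X : Type u} (R : ImTerm X → ImTerm X → Prop)
    (a b : FreeFInverseMonoid X) : Prop :=
  ∃ p q, R p q ∧ a = ImTerm.val maxi FreeFInverseMonoid.of p ∧
    b = ImTerm.val maxi FreeFInverseMonoid.of q

/-- The F-inverse monoid `FInv⟨X ∣ R⟩`: the quotient of the free F-inverse monoid on `X` by the
congruence generated by `R`. -/
abbrev FInvPres {X : Type u} (R : ImTerm X → ImTerm X → Prop) : Type u := FQuotient (termRel R)

/-- The generators of `FInv⟨X ∣ R⟩`. -/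
def FInvPres.of {X : Type u} (R : ImTerm X → ImTerm X → Prop) (x : X) : FInvPres R :=
  FQuotient.mk _ (FreeFInverseMonoid.of x)

/-! ## Cayley graphs of groups and their subgraphs -/

/-- The formal inverse of a letter. -/
def letterInv {X : Type u} (a : X × Bool) : X × Bool := (a.1, !a.2)

theorem letterVal_letterInv {X : Type u} {G : Type v} [Group G] (ι : X → G) (a : X × Bool) :
    letterVal ι (letterInv a) = (letterVal ι a)⁻¹ := by
  rcases a with ⟨x, _ | _⟩ <;> simp [letterVal, letterInv]

/-- Subgraphs of the Cayley graph of the group `G` with respect to `ι : X → G`.  The vertices of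
the Cayley graph are the elements of `G`, and its edges are the pairs `(g, a)` with `g ∈ G` and
`a ∈ X ∪ X⁻¹`, where `(g, a)` has label `a`, starts at `g`, ends at `g a_G` and has inverse
`(g a_G, a⁻¹)`. -/
@[ext]
structure CayleySubgraph {X : Type u} {G : Type v} [Group G] (ι : X → G) where
  verts : Set G
  edges : Set (G × (X × Bool))
  source_mem : ∀ g a, (g, a) ∈ edges → g ∈ verts
  target_mem : ∀ g a, (g, a) ∈ edges → g * letterVal ι a ∈ verts
  inv_mem : ∀ g a, (g, a) ∈ edges → (g * letterVal ι a, letterInv a) ∈ edges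

namespace CayleySubgraph

variable {X : Type u} {G : Type v} [Group G] {ι : X → G}

instance : PartialOrder (CayleySubgraph ι) where
  le Δ Ξ := Δ.verts ⊆ Ξ.verts ∧ Δ.edges ⊆ Ξ.edges
  le_refl _ := ⟨subset_rfl, subset_rfl⟩
  le_trans _ _ _ h1 h2 := ⟨h1.1.trans h2.1, h1.2.trans h2.2⟩
  le_antisymm _ _ h1 h2 := CayleySubgraph.ext (h1.1.antisymm h2.1) (h1.2.antisymm h2.2)

instance : Max (CayleySubgraph ι) where
  max Δ Ξ :=
    { verts := Δ.verts ∪ Ξ.verts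
      edges := Δ.edges ∪ Ξ.edges
      source_mem := fun g a h => h.imp (Δ.source_mem g a) (Ξ.source_mem g a)
      target_mem := fun g a h => h.imp (Δ.target_mem g a) (Ξ.target_mem g a)
      inv_mem := fun g a h => h.imp (Δ.inv_mem g a) (Ξ.inv_mem g a) }

instance : Min (CayleySubgraph ι) where
  min Δ Ξ :=
    { verts := Δ.verts ∩ Ξ.verts
      edges := Δ.edges ∩ Ξ.edges
      source_mem := fun g a h => h.imp (Δ.source_mem g a) (Ξ.source_mem g a)
      target_mem := fun g a h => h.imp (Δ.target_mem g a) (Ξ.target_mem g a)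
      inv_mem := fun g a h => h.imp (Δ.inv_mem g a) (Ξ.inv_mem g a) }

instance : SupSet (CayleySubgraph ι) where
  sSup s :=
    { verts := {g | ∃ Δ ∈ s, g ∈ Δ.verts}
      edges := {e | ∃ Δ ∈ s, e ∈ Δ.edges}
      source_mem := fun g a ⟨Δ, hΔ, h⟩ => ⟨Δ, hΔ, Δ.source_mem g a h⟩
      target_mem := fun g a ⟨Δ, hΔ, h⟩ => ⟨Δ, hΔ, Δ.target_mem g a h⟩
      inv_mem := fun g a ⟨Δ, hΔ, h⟩ => ⟨Δ, hΔ, Δ.inv_mem g a h⟩ }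

instance : InfSet (CayleySubgraph ι) where
  sInf s :=
    { verts := {g | ∀ Δ ∈ s, g ∈ Δ.verts}
      edges := {e | ∀ Δ ∈ s, e ∈ Δ.edges}
      source_mem := fun g a h Δ hΔ => Δ.source_mem g a (h Δ hΔ)
      target_mem := fun g a h Δ hΔ => Δ.target_mem g a (h Δ hΔ)
      inv_mem := fun g a h Δ hΔ => Δ.inv_mem g a (h Δ hΔ) }

instance : Top (CayleySubgraph ι) where
  top := ⟨Set.univ, Set.univ, fun _ _ _ => trivial, fun _ _ _ => trivial, fun _ _ _ => trivial⟩

instance : Bot (CayleySubgraph ι) where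
  bot := ⟨∅, ∅, fun _ _ h => h.elim, fun _ _ h => h.elim, fun _ _ h => h.elim⟩

/-- The complete lattice `Sub Γ_X` of all subgraphs, under inclusion. -/
instance : CompleteLattice (CayleySubgraph ι) where
  sup := max
  inf := min
  le_sup_left _ _ := ⟨Set.subset_union_left, Set.subset_union_left⟩
  le_sup_right _ _ := ⟨Set.subset_union_right, Set.subset_union_right⟩
  sup_le _ _ _ h1 h2 := ⟨Set.union_subset h1.1 h2.1, Set.union_subset h1.2 h2.2⟩
  inf_le_left _ _ := ⟨Set.inter_subset_left, Set.inter_subset_left⟩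
  inf_le_right _ _ := ⟨Set.inter_subset_right, Set.inter_subset_right⟩
  le_inf _ _ _ h1 h2 := ⟨Set.subset_inter h1.1 h2.1, Set.subset_inter h1.2 h2.2⟩
  isLUB_sSup s := ⟨fun Δ hΔ => ⟨fun _ h => ⟨Δ, hΔ, h⟩, fun _ h => ⟨Δ, hΔ, h⟩⟩,
    fun _ hΞ => ⟨fun _ ⟨_, hΔ, h⟩ => (hΞ hΔ).1 h, fun _ ⟨_, hΔ, h⟩ => (hΞ hΔ).2 h⟩⟩
  isGLB_sInf s := ⟨fun Δ hΔ => ⟨fun _ h => h Δ hΔ, fun _ h => h Δ hΔ⟩,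
    fun _ hΞ => ⟨fun _ h _ hΔ => (hΞ hΔ).1 h, fun _ h _ hΔ => (hΞ hΔ).2 h⟩⟩
  le_top _ := ⟨fun _ _ => trivial, fun _ _ => trivial⟩
  bot_le _ := ⟨fun _ h => h.elim, fun _ h => h.elim⟩

/-- The left action of `G` on the subgraphs of its Cayley graph: `gΔ`. -/
instance : MulAction G (CayleySubgraph ι) where
  smul g Δ :=
    { verts := {h | g⁻¹ * h ∈ Δ.verts}
      edges := {e | (g⁻¹ * e.1, e.2) ∈ Δ.edges}
      source_mem := fun _ _ he => Δ.source_mem _ _ he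
      target_mem := fun _ _ he => by
        have := Δ.target_mem _ _ he
        rwa [mul_assoc] at this
      inv_mem := fun _ _ he => by
        have := Δ.inv_mem _ _ he
        rwa [mul_assoc] at this }
  one_smul Δ := by
    apply CayleySubgraph.ext
    · ext h; change (1 : G)⁻¹ * h ∈ Δ.verts ↔ _; simp
    · ext ⟨h, a⟩; change ((1 : G)⁻¹ * h, a) ∈ Δ.edges ↔ _; simp
  mul_smul g k Δ := by
    apply CayleySubgraph.ext
    · ext h; change (g * k)⁻¹ * h ∈ Δ.verts ↔ k⁻¹ * (g⁻¹ * h) ∈ Δ.verts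
      rw [mul_inv_rev, mul_assoc]
    · ext ⟨h, a⟩
      change ((g * k)⁻¹ * h, a) ∈ Δ.edges ↔ (k⁻¹ * (g⁻¹ * h), a) ∈ Δ.edges
      rw [mul_inv_rev, mul_assoc]

theorem mem_smul_verts {g h : G} {Δ : CayleySubgraph ι} :
    h ∈ (g • Δ).verts ↔ g⁻¹ * h ∈ Δ.verts := Iff.rfl

theorem mem_smul_edges {g h : G} {a : X × Bool} {Δ : CayleySubgraph ι} :
    (h, a) ∈ (g • Δ).edges ↔ (g⁻¹ * h, a) ∈ Δ.edges := Iff.rfl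

theorem smul_mono {g : G} {Δ Ξ : CayleySubgraph ι} (h : Δ ≤ Ξ) : g • Δ ≤ g • Ξ :=
  ⟨fun _ hv => h.1 hv, fun _ he => h.2 he⟩

theorem smul_sup (g : G) (Δ Ξ : CayleySubgraph ι) : g • (Δ ⊔ Ξ) = g • Δ ⊔ g • Ξ := rfl

/-- A subgraph is finite if it has finitely many vertices and edges. -/
def IsFinite (Δ : CayleySubgraph ι) : Prop := Δ.verts.Finite ∧ Δ.edges.Finite

theorem IsFinite.sup {Δ Ξ : CayleySubgraph ι} (h1 : Δ.IsFinite) (h2 : Ξ.IsFinite) :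
    (Δ ⊔ Ξ).IsFinite := ⟨h1.1.union h2.1, h1.2.union h2.2⟩

theorem IsFinite.smul {Δ : CayleySubgraph ι} (h : Δ.IsFinite) (g : G) : (g • Δ).IsFinite := by
  refine ⟨h.1.preimage (mul_right_injective g⁻¹).injOn,
    h.2.preimage (f := fun e : G × (X × Bool) => (g⁻¹ * e.1, e.2)) ?_⟩
  rintro ⟨a, b⟩ _ ⟨c, d⟩ _ hab
  simpa using hab

/-- The word `w` labels a path from `g` to `h` in `Δ`. -/
def LabelsPath (Δ : CayleySubgraph ι) : InvWord X → G → G → Prop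
  | [], g, h => g ∈ Δ.verts ∧ g = h
  | a :: w, g, h => (g, a) ∈ Δ.edges ∧ LabelsPath Δ w (g * letterVal ι a) h

/-- The term `w` labels a journey from `g` to `h` in `Δ`: a letter traverses an edge of `Δ`, and a
symbol `v^𝔪` jumps from the current position `k` to `k v_G`, all positions being vertices
of `Δ`. -/
def LabelsJourney (Δ : CayleySubgraph ι) : ImTerm X → G → G → Prop
  | [], g, h => g ∈ Δ.verts ∧ g = h
  | Sum.inl a :: w, g, h => (g, a) ∈ Δ.edges ∧ LabelsJourney Δ w (g * letterVal ι a) h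
  | Sum.inr v :: w, g, h => g ∈ Δ.verts ∧ LabelsJourney Δ w (g * wordVal ι v) h

/-- Any two vertices are joined by a path; the empty subgraph is included. -/
def Connected (Δ : CayleySubgraph ι) : Prop :=
  ∀ g ∈ Δ.verts, ∀ h ∈ Δ.verts, ∃ w, Δ.LabelsPath w g h

/-- `Δ` is closed with respect to `R`: for every pair in `R` and all vertices `g`, `h` of `Δ`, one
term of the pair labels a journey from `g` to `h` in `Δ` if and only if the other one does. -/
def RelClosed (R : ImTerm X → ImTerm X → Prop) (Δ : CayleySubgraph ι) : Prop :=
  ∀ p q, R p q → ∀ g ∈ Δ.verts, ∀ h ∈ Δ.verts, Δ.LabelsJourney p g h ↔ Δ.LabelsJourney q g h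

/-- The subgraph consisting of the single vertex `g`. -/
def vertex (ι : X → G) (g : G) : CayleySubgraph ι :=
  ⟨{g}, ∅, fun _ _ h => h.elim, fun _ _ h => h.elim, fun _ _ h => h.elim⟩

/-- The subgraph spanned by the edge `(g, a)`. -/
def edge (ι : X → G) (g : G) (a : X × Bool) : CayleySubgraph ι where
  verts := {g, g * letterVal ι a}
  edges := {(g, a), (g * letterVal ι a, letterInv a)}
  source_mem := by
    rintro h b (hb | hb) <;> (cases hb; simp)
  target_mem := by
    rintro h b (hb | hb) <;> (cases hb; simp [letterVal_letterInv])
  inv_mem := by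
    rintro h b (hb | hb) <;> cases hb
    · exact Or.inr rfl
    · refine Or.inl ?_
      rw [letterVal_letterInv, mul_inv_cancel_right]
      simp [letterInv]

/-- The subgraph `⟨g w̄⟩` spanned by the path labelled by the word `w` starting at `g`. -/
def pathSpan (ι : X → G) : G → InvWord X → CayleySubgraph ι
  | g, [] => vertex ι g
  | g, a :: w => edge ι g a ⊔ pathSpan ι (g * letterVal ι a) w

theorem labelsJourney_smul (k : G) (Δ : CayleySubgraph ι) (p : ImTerm X) (g h : G) :
    (k • Δ).LabelsJourney p g h ↔ Δ.LabelsJourney p (k⁻¹ * g) (k⁻¹ * h) := by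
  induction p generalizing g with
  | nil => simp [LabelsJourney, mem_smul_verts]
  | cons a p ih =>
    rcases a with a | v
    · simp [LabelsJourney, mem_smul_edges, ih, mul_assoc]
    · simp [LabelsJourney, mem_smul_verts, ih, mul_assoc]

theorem RelClosed.smul {R : ImTerm X → ImTerm X → Prop} {Δ : CayleySubgraph ι}
    (h : Δ.RelClosed R) (k : G) : (k • Δ).RelClosed R := by
  intro p q hpq g hg l hl
  rw [labelsJourney_smul, labelsJourney_smul]
  exact h p q hpq _ hg _ hl

theorem labelsJourney_end {Δ : CayleySubgraph ι} {p : ImTerm X} {g h : G}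
    (hp : Δ.LabelsJourney p g h) : g * p.val id ι = h := by
  induction p generalizing g with
  | nil => simpa [ImTerm.val] using hp.2
  | cons a p ih =>
    have key : g * ImTerm.val id ι (a :: p) =
        g * Sum.elim (letterVal ι) (fun v => id (wordVal ι v)) a * ImTerm.val id ι p := by
      simp [ImTerm.val, mul_assoc]
    rw [key]
    rcases a with a | v <;> exact ih hp.2

theorem labelsJourney_top (p : ImTerm X) (g : G) :
    (⊤ : CayleySubgraph ι).LabelsJourney p g (g * p.val id ι) := by
  induction p generalizing g with
  | nil => exact ⟨trivial, by simp [ImTerm.val]⟩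
  | cons a p ih =>
    have key : g * ImTerm.val id ι (a :: p) =
        g * Sum.elim (letterVal ι) (fun v => id (wordVal ι v)) a * ImTerm.val id ι p := by
      simp [ImTerm.val, mul_assoc]
    rw [key]
    rcases a with a | v <;> exact ⟨trivial, ih _⟩

theorem labelsJourney_sInf {s : Set (CayleySubgraph ι)} (hs : s.Nonempty) (p : ImTerm X)
    (g h : G) : (sInf s).LabelsJourney p g h ↔ ∀ Δ ∈ s, Δ.LabelsJourney p g h := by
  obtain ⟨Δ₀, h₀⟩ := hs
  induction p generalizing g with
  | nil => exact ⟨fun hp Δ hΔ => ⟨hp.1 Δ hΔ, hp.2⟩,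
      fun hp => ⟨fun Δ hΔ => (hp Δ hΔ).1, (hp Δ₀ h₀).2⟩⟩
  | cons a p ih =>
    rcases a with a | v
    · exact ⟨fun hp Δ hΔ => ⟨hp.1 Δ hΔ, (ih _).1 hp.2 Δ hΔ⟩,
        fun hp => ⟨fun Δ hΔ => (hp Δ hΔ).1, (ih _).2 fun Δ hΔ => (hp Δ hΔ).2⟩⟩
    · exact ⟨fun hp Δ hΔ => ⟨hp.1 Δ hΔ, (ih _).1 hp.2 Δ hΔ⟩,
        fun hp => ⟨fun Δ hΔ => (hp Δ hΔ).1, (ih _).2 fun Δ hΔ => (hp Δ hΔ).2⟩⟩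

end CayleySubgraph

/-! ## Closure operators and the associated monoids -/

/-- `G`-invariant closure operators on the subgraphs of a Cayley graph. -/
structure InvariantClosure {X : Type u} {G : Type v} [Group G] (ι : X → G) where
  op : ClosureOperator (CayleySubgraph ι)
  map_smul : ∀ (g : G) (Δ : CayleySubgraph ι), op (g • Δ) = g • op Δ

/-- The closure operator `c_R`, whose closed elements are the subgraphs closed with respect to `R`,
for a relation `R` any two related terms of which are equal in `G`. -/
def relClosure {X : Type u} {G : Type v} [Group G] (ι : X → G) (R : ImTerm X → ImTerm X → Prop)
    (hR : ∀ p q, R p q → p.val id ι = q.val id ι) : InvariantClosure ι :=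
  let c := ClosureOperator.ofCompletePred (CayleySubgraph.RelClosed (ι := ι) R) (by
    intro s hs p q hpq g hg h hh
    rcases s.eq_empty_or_nonempty with rfl | hne
    · rw [sInf_empty]
      constructor
      · intro hp
        rw [← CayleySubgraph.labelsJourney_end hp, hR p q hpq]
        exact CayleySubgraph.labelsJourney_top q g
      · intro hp
        rw [← CayleySubgraph.labelsJourney_end hp, ← hR p q hpq]
        exact CayleySubgraph.labelsJourney_top p g
    · rw [CayleySubgraph.labelsJourney_sInf hne, CayleySubgraph.labelsJourney_sInf hne]
      exact forall₂_congr fun Δ hΔ => hs Δ hΔ p q hpq g (hg Δ hΔ) h (hh Δ hΔ))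
  { op := c
    map_smul := by
      have hc : ∀ (g : G) (Δ : CayleySubgraph ι), c (g • Δ) ≤ g • c Δ := fun g Δ =>
        ClosureOperator.closure_min (CayleySubgraph.smul_mono (c.le_closure Δ))
          (CayleySubgraph.RelClosed.smul (c.isClosed_closure Δ) g)
      intro g Δ
      refine (hc g Δ).antisymm ?_
      have h := CayleySubgraph.smul_mono (g := g) (hc g⁻¹ (g • Δ))
      rwa [inv_smul_smul, smul_inv_smul] at h }

/-- The compact subgraphs: the closures of finite subgraphs. -/
def IsCompactSubgraph {X : Type u} {G : Type v} [Group G] {ι : X → G} (c : InvariantClosure ι)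
    (Δ : CayleySubgraph ι) : Prop :=
  ∃ F : CayleySubgraph ι, F.IsFinite ∧ Δ = c.op F

/-- The set `S_c` of the pairs `(Δ, g)` with `g ∈ G` and `Δ` a compact subgraph containing the
vertices `1` and `g`. -/
@[ext]
structure ClosureMonoid {X : Type u} {G : Type v} [Group G] {ι : X → G}
    (c : InvariantClosure ι) where
  graph : CayleySubgraph ι
  elt : G
  compact : IsCompactSubgraph c graph
  one_mem : 1 ∈ graph.verts
  elt_mem : elt ∈ graph.verts

namespace ClosureMonoid

variable {X : Type u} {G : Type v} [Group G] {ι : X → G} {c : InvariantClosure ι}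

/-- `(Δ, g)(Ξ, h) = ((Δ ∪ gΞ)^c, gh)`. -/
instance : Mul (ClosureMonoid c) where
  mul s t :=
    { graph := c.op (s.graph ⊔ s.elt • t.graph)
      elt := s.elt * t.elt
      compact := by
        obtain ⟨F, hF, hs⟩ := s.compact
        obtain ⟨H, hH, ht⟩ := t.compact
        refine ⟨F ⊔ s.elt • H, hF.sup (hH.smul _), ?_⟩
        rw [hs, ht, ← c.map_smul, ClosureOperator.closure_sup_closure]
      one_mem := (c.op.le_closure _).1 (Or.inl s.one_mem)
      elt_mem := (c.op.le_closure _).1 (Or.inr (by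
        rw [CayleySubgraph.mem_smul_verts, inv_mul_cancel_left]; exact t.elt_mem)) }

/-- `({1}^c, 1)`. -/
instance : One (ClosureMonoid c) where
  one :=
    { graph := c.op (CayleySubgraph.vertex ι 1)
      elt := 1
      compact := ⟨_, ⟨Set.finite_singleton _, Set.finite_empty⟩, rfl⟩
      one_mem := (c.op.le_closure _).1 rfl
      elt_mem := (c.op.le_closure _).1 rfl }

/-- `(Δ, g)⁻¹ = (g⁻¹Δ, g⁻¹)`. -/
instance : Inv (ClosureMonoid c) where
  inv s :=
    { graph := s.elt⁻¹ • s.graph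
      elt := s.elt⁻¹
      compact := by
        obtain ⟨F, hF, hs⟩ := s.compact
        exact ⟨s.elt⁻¹ • F, hF.smul _, by rw [hs, c.map_smul]⟩
      one_mem := by
        rw [CayleySubgraph.mem_smul_verts, inv_inv, mul_one]; exact s.elt_mem
      elt_mem := by
        rw [CayleySubgraph.mem_smul_verts, inv_inv, mul_inv_cancel]; exact s.one_mem }

/-- `(Δ, g)^𝔪 = ({1, g}^c, g)`. -/
def maxi (s : ClosureMonoid c) : ClosureMonoid c where
  graph := c.op (CayleySubgraph.vertex ι 1 ⊔ CayleySubgraph.vertex ι s.elt)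
  elt := s.elt
  compact := ⟨_, CayleySubgraph.IsFinite.sup ⟨Set.finite_singleton _, Set.finite_empty⟩
    ⟨Set.finite_singleton _, Set.finite_empty⟩, rfl⟩
  one_mem := (c.op.le_closure _).1 (Or.inl rfl)
  elt_mem := (c.op.le_closure _).1 (Or.inr rfl)

end ClosureMonoid

/-! ## The presentation `FInv⟨X ∣ red(w) = w^𝔪, w ∈ (X ∪ X⁻¹)*⟩` -/

/-- The relations `red(w) = w^𝔪`, for all words `w` over `X ∪ X⁻¹`. -/
def redRel (X : Type u) (p q : ImTerm X) : Prop :=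
  ∃ w : InvWord X, p = ImTerm.ofWord (red w) ∧ q = ImTerm.maxWord w

theorem wordVal_freeGroup {X : Type u} (w : InvWord X) :
    wordVal FreeGroup.of w = FreeGroup.mk w := by
  induction w with
  | nil => rfl
  | cons a w ih =>
    rw [← List.singleton_append, ← FreeGroup.mul_mk, ← ih]
    rcases a with ⟨x, _ | _⟩ <;> simp [wordVal, letterVal, FreeGroup.of, FreeGroup.invRev]

/-- The two sides of each relation are equal in the free group. -/
theorem redRel_compatible {X : Type u} (p q : ImTerm X) (h : redRel X p q) :
    p.val id (FreeGroup.of : X → FreeGroup X) = q.val id FreeGroup.of := by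
  obtain ⟨w, rfl, rfl⟩ := h
  have h1 : (ImTerm.ofWord (red w)).val id (FreeGroup.of : X → FreeGroup X) =
      wordVal FreeGroup.of (red w) := by
    simp [ImTerm.val, ImTerm.ofWord, wordVal, Function.comp_def]
  have h2 : (ImTerm.maxWord w).val id (FreeGroup.of : X → FreeGroup X) =
      wordVal FreeGroup.of w := by
    simp [ImTerm.val, ImTerm.maxWord]
  rw [h1, h2, wordVal_freeGroup, wordVal_freeGroup]
  let := Classical.decEq X
  exact FreeGroup.reduce.self

/-- The closure operator `c_R` of the presentation, on the subgraphs of the Cayley graph of the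
free group on `X`. -/
def redClosure (X : Type u) : InvariantClosure (FreeGroup.of : X → FreeGroup X) :=
  relClosure FreeGroup.of (redRel X) redRel_compatible

end

noncomputable section

universe u v

open InverseMonoid FInverseMonoid

/-! ## Values of words in inverse monoids -/

section Words

variable {X : Type u} {M : Type v}

/-! The heart is Munn's theorem: a word is determined in the free inverse monoid by its end point in
the free group and the subtree that its path from `1` spans. The Munn tree respects the Vagner
relations because a path followed back and forth spans nothing new and joins of subgraphs are
idempotent and commutative. It separates words for an algebraic reason, valid in every inverse
monoid. Deleting a cancelling pair moves a value up in the natural order, so `w = (w w⁻¹) red(w)`;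
and `w w⁻¹` is the meet of the idempotents `r r⁻¹`, where `r` runs over the reduced forms of the
prefixes of `w`, that is, over the geodesics from `1` to the vertices visited
(`idem_le_redIdem_of_prefix`, `idem_le_of_forall_prefix`, `wordVal_eq_of_prefixes`). Every finite
connected subgraph is the span of some path, which gives surjectivity.

The free group component is constant on `σ`-classes, and `w` lies below `red w`, so `red w` is the
greatest element of the class of `w`. Hence the relations `red(w) = w^𝔪` hold in the free inverse
monoid. In the presented monoid they express `𝔪` on words through words alone, so the universal
properties of the two monoids yield mutually inverse homomorphisms.

On the graph side, `w^𝔪` jumps freely between vertices, so closedness forces any two vertices to be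
joined by a geodesic; conversely every path in the Cayley tree contains the geodesic between its
ends (`pathSpan_le_of_red`). Closed therefore means connected, compact means finite and connected,
and the closure of `{1, w}` is the path of `red w`. -/

@[simp] theorem wordVal_nil [Monoid M] [Inv M] (ι : X → M) : wordVal ι [] = 1 := rfl

theorem wordVal_append [Monoid M] [Inv M] (ι : X → M) (w z : InvWord X) :
    wordVal ι (w ++ z) = wordVal ι w * wordVal ι z := by
  simp [wordVal]

theorem wordVal_cons [Monoid M] [Inv M] (ι : X → M) (a : X × Bool) (w : InvWord X) :
    wordVal ι (a :: w) = letterVal ι a * wordVal ι w := by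
  simp [wordVal]

theorem wordVal_singleton [Monoid M] [Inv M] (ι : X → M) (a : X × Bool) :
    wordVal ι [a] = letterVal ι a := by
  simp [wordVal]

theorem invRev_cons_eq (a : X × Bool) (w : InvWord X) :
    FreeGroup.invRev (a :: w) = FreeGroup.invRev w ++ [letterInv a] := by
  simp [FreeGroup.invRev, letterInv]

theorem letterInv_letterInv (a : X × Bool) : letterInv (letterInv a) = a := by
  simp [letterInv]

variable [InverseMonoid M] (ι : X → M)

theorem letterVal_inv (a : X × Bool) : letterVal ι (letterInv a) = (letterVal ι a)⁻¹ := by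
  rcases a with ⟨x, _ | _⟩ <;> simp [letterVal, letterInv]

theorem wordVal_invRev (w : InvWord X) :
    wordVal ι (FreeGroup.invRev w) = (wordVal ι w)⁻¹ := by
  induction w with
  | nil => simp [inv_one']
  | cons a w ih =>
    rw [invRev_cons_eq, wordVal_append, ih, wordVal_singleton, letterVal_inv, wordVal_cons,
      mul_inv_r]

/-- A monoid homomorphism preserving inverses preserves the values of words. -/
theorem map_wordVal {N : Type*} [InverseMonoid N] {F : Type*} [FunLike F M N]
    [MonoidHomClass F M N] (f : F)
    (hf : ∀ s, f s⁻¹ = (f s)⁻¹) (w : InvWord X) :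
    f (wordVal ι w) = wordVal (fun x => f (ι x)) w := by
  induction w with
  | nil => exact map_one f
  | cons a w ih =>
    rw [wordVal_cons, wordVal_cons, map_mul, ih]
    rcases a with ⟨x, _ | _⟩ <;> simp [letterVal, hf]

/-- Free reduction moves up in the natural partial order. -/
theorem wordVal_le_of_red {w z : InvWord X} (h : FreeGroup.Red w z) :
    NatLE (wordVal ι w) (wordVal ι z) := by
  induction h with
  | refl => exact NatLE.refl _
  | tail _ h ih =>
    refine ih.trans ?_
    cases h with
    | @not L₁ L₂ x b =>
      have e : L₁ ++ (x, b) :: (x, !b) :: L₂ = (L₁ ++ ([(x, b)] ++ [letterInv (x, b)])) ++ L₂ := by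
        simp [letterInv]
      rw [e, wordVal_append, wordVal_append, wordVal_append, wordVal_append ι L₁ L₂]
      refine NatLE.mul ?_ (NatLE.refl _)
      rw [wordVal_singleton, wordVal_singleton, letterVal_inv]
      exact mul_idem_le _ (rr_idem _)

/-! ### Free reduction of words. -/

theorem red_red (w : InvWord X) : FreeGroup.Red w (red w) :=
  letI := Classical.decEq X
  FreeGroup.reduce.red

theorem red_eq_iff {w z : InvWord X} : red w = red z ↔ FreeGroup.mk w = FreeGroup.mk z :=
  letI := Classical.decEq X
  ⟨FreeGroup.reduce.exact, FreeGroup.reduce.sound⟩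

theorem mk_red (w : InvWord X) : FreeGroup.mk (red w) = FreeGroup.mk w :=
  letI := Classical.decEq X
  FreeGroup.reduce.self

theorem red_eq_self_iff {w : InvWord X} : red w = w ↔ FreeGroup.IsReduced w :=
  letI := Classical.decEq X
  FreeGroup.isReduced_iff_reduce_eq.symm

theorem isReduced_red (w : InvWord X) : FreeGroup.IsReduced (red w) :=
  red_eq_self_iff.1 (red_eq_iff.2 (mk_red w))

/-- One more letter is one step in the Cayley tree, either away from `1` or back along the last edge
of the geodesic. It drives the letter-by-letter induction in `mul_wordVal_eq_mul_red`. -/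
theorem red_append_singleton (w : InvWord X) (a : X × Bool) :
    red (w ++ [a]) = red w ++ [a] ∨ red w = red (w ++ [a]) ++ [letterInv a] := by
  have hred : red (w ++ [a]) = red (red w ++ [a]) :=
    red_eq_iff.2 (by rw [← FreeGroup.mul_mk, ← FreeGroup.mul_mk, mk_red])
  have hw := isReduced_red w
  rw [hred]
  generalize red w = s at hw
  rcases List.eq_nil_or_concat s with rfl | ⟨t, b, rfl⟩
  · exact Or.inl (red_eq_self_iff.2 FreeGroup.IsReduced.singleton)
  · rw [List.concat_eq_append] at *
    by_cases hb : b = letterInv a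
    · right
      subst hb
      have ht : FreeGroup.IsReduced t := hw.infix ⟨[], [letterInv a], by simp⟩
      have : red (t ++ [letterInv a] ++ [a]) = red t := by
        rw [red_eq_iff]
        have h : FreeGroup.mk [letterInv a] = (FreeGroup.mk [a])⁻¹ := rfl
        rw [← FreeGroup.mul_mk, ← FreeGroup.mul_mk, h, inv_mul_cancel_right]
      rw [this, red_eq_self_iff.2 ht]
    · left
      rw [red_eq_self_iff]
      -- Only the pair at the junction is new. If its letters share a generator they share the sign
      -- too, since `b` is not the inverse of `a`.
      refine List.isChain_append.2 ⟨hw, List.isChain_singleton a, ?_⟩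
      rcases a with ⟨x, i⟩
      rcases b with ⟨y, j⟩
      simp only [List.getLast?_append, List.getLast?_singleton, List.head?_cons, letterInv,
        Prod.mk.injEq, Option.some_or, Option.mem_some_iff] at hb ⊢
      rintro _ rfl _ rfl h
      cases i <;> cases j <;> simp_all

/-! ### Idempotents of geodesics and the algebraic half of Munn's theorem. -/

/-- The idempotent `r r⁻¹`, where `r` is the reduced form of `w`. -/
def redIdem (w : InvWord X) : M := wordVal ι (red w) * (wordVal ι (red w))⁻¹

/-- Since `q q⁻¹` is idempotent, `p q q⁻¹ p⁻¹ ≤ p p⁻¹`; reducing `p` moves further up. -/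
theorem idem_le_redIdem_of_prefix {p w : InvWord X} (h : p <+: w) :
    NatLE (wordVal ι w * (wordVal ι w)⁻¹) (redIdem ι p) := by
  obtain ⟨q, rfl⟩ := h
  have h1 : NatLE (wordVal ι (p ++ q) * (wordVal ι (p ++ q))⁻¹)
      (wordVal ι p * (wordVal ι p)⁻¹) := by
    rw [wordVal_append, mul_inv_r]
    have := mul_idem_le (wordVal ι p) (rr_idem (wordVal ι q))
    simpa only [mul_assoc] using this.mul (NatLE.refl (wordVal ι p)⁻¹)
  have h2 := wordVal_le_of_red ι (red_red p)
  exact h1.trans (h2.mul h2.inv)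

/-- An idempotent below the geodesic idempotents of all prefixes absorbs every backtracking of the
path, so cancelling pairs may be deleted behind it at no cost. -/
theorem mul_wordVal_eq_mul_red {f : M} (hf : f * f = f) (w : InvWord X)
    (h : ∀ p, p <+: w → NatLE f (redIdem ι p)) :
    f * wordVal ι w = f * wordVal ι (red w) := by
  have hle : ∀ p, p <+: w → f * redIdem ι p = f := fun p hp => by
    have := h p hp
    unfold NatLE at this
    rw [idem_mul_inv hf] at this
    exact this.symm
  clear h
  induction w using List.reverseRecOn with
  | nil => rfl
  | append_singleton u a ih =>
    have ih := ih fun p hp => hle p (hp.trans (List.prefix_append _ _))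
    rw [wordVal_append, ← mul_assoc, ih]
    rcases red_append_singleton u a with h | h
    · rw [h, wordVal_append, mul_assoc]
    -- The letter `a` backtracks: with `t = red (u ++ [a])` and `x` the value of `a`, the value of
    -- `red u` is `t x⁻¹`, and `hu` says that `f` absorbs `t x⁻¹ x t⁻¹`.
    · have hu := hle u (List.prefix_append _ _)
      unfold redIdem at hu
      simp only [h, wordVal_append, wordVal_singleton, letterVal_inv] at hu ⊢
      generalize wordVal ι (red (u ++ [a])) = t at *
      generalize letterVal ι a = x at *
      rw [mul_inv_r, inv_inv] at hu
      have c := idem_comm (e := x⁻¹ * x) (f := t⁻¹ * t) (by simpa using rr_idem x⁻¹)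
        (by simpa using rr_idem t⁻¹)
      -- Inserting `t⁻¹ t` and commuting it past `x⁻¹ x` exposes the idempotent absorbed by `f`.
      calc f * (t * x⁻¹) * x = f * (t * (t⁻¹ * t)) * (x⁻¹ * x) := by
            rw [mul_inv_mul]; simp only [mul_assoc]
        _ = f * t * (x⁻¹ * x * (t⁻¹ * t)) := by rw [c]; simp only [mul_assoc]
        _ = f * (t * x⁻¹ * (x * t⁻¹)) * t := by simp only [mul_assoc]
        _ = f * t := by rw [hu]

/-- With `idem_le_redIdem_of_prefix`, this makes `w w⁻¹` the meet of the geodesic idempotents of its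
prefixes. Since `f w = f red(w)`, conjugating gives `f (w w⁻¹) f = f (r r⁻¹) f = f` for `r = red w`.
-/
theorem idem_le_of_forall_prefix {f : M} (hf : f * f = f) {w : InvWord X}
    (h : ∀ p, p <+: w → NatLE f (redIdem ι p)) :
    NatLE f (wordVal ι w * (wordVal ι w)⁻¹) := by
  have h1 := mul_wordVal_eq_mul_red ι hf w h
  have h2 := h w List.prefix_rfl
  unfold redIdem at h2
  unfold NatLE at h2 ⊢
  rw [idem_mul_inv hf] at h2 ⊢
  have h3 : f * wordVal ι w * (f * wordVal ι w)⁻¹ = f := by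
    rw [h1, mul_inv_r, idem_inv_eq hf]
    calc _ = f * (wordVal ι (red w) * (wordVal ι (red w))⁻¹) * f := by simp only [mul_assoc]
      _ = f := by rw [← h2, hf]
  rw [mul_inv_r, idem_inv_eq hf] at h3
  have h4 := idem_comm hf (rr_idem (wordVal ι w))
  calc f = f * (wordVal ι w * (wordVal ι w)⁻¹ * f) := by
        conv_lhs => rw [← h3]
        simp only [mul_assoc]
    _ = f * (wordVal ι w * (wordVal ι w)⁻¹) := by rw [← h4, ← mul_assoc, hf]

/-- Two words with the same value in the free group whose paths from `1` visit the same vertices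
of the Cayley tree have the same value in every inverse monoid. -/
theorem wordVal_eq_of_prefixes {w z : InvWord X} (h : FreeGroup.mk w = FreeGroup.mk z)
    (hp : {g | ∃ p, p <+: w ∧ FreeGroup.mk p = g} = {g | ∃ p, p <+: z ∧ FreeGroup.mk p = g}) :
    wordVal ι w = wordVal ι z := by
  have key : ∀ {w z : InvWord X},
      {g | ∃ p, p <+: w ∧ FreeGroup.mk p = g} = {g | ∃ p, p <+: z ∧ FreeGroup.mk p = g} →
      NatLE (wordVal ι w * (wordVal ι w)⁻¹) (wordVal ι z * (wordVal ι z)⁻¹) := by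
    intro w z hp
    refine idem_le_of_forall_prefix ι (rr_idem _) fun p hpz => ?_
    obtain ⟨q, hq, hqp⟩ := hp.symm.subset ⟨p, hpz, rfl⟩
    -- The idempotent depends only on the vertex reached, so a prefix of `z` can be traded for a
    -- prefix of `w`.
    have : redIdem ι p = redIdem ι q := by
      unfold redIdem
      rw [red_eq_iff.2 hqp]
    rw [this]
    exact idem_le_redIdem_of_prefix ι hq
  -- Each word equals its idempotent times its reduced form. The idempotents agree by `key` in both
  -- directions, the reduced forms because the end points agree.
  have hw := wordVal_le_of_red ι (red_red w)
  have hz := wordVal_le_of_red ι (red_red z)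
  unfold NatLE at hw hz
  rw [hw, hz, (key hp).antisymm (key hp.symm), red_eq_iff.2 h]

end Words

/-! ## Paths in Cayley graphs -/

namespace CayleySubgraph

variable {X : Type u} {G : Type v} [Group G] {ι : X → G}

theorem wordVal_invRev_group (ι : X → G) (w : InvWord X) :
    wordVal ι (FreeGroup.invRev w) = (wordVal ι w)⁻¹ := by
  induction w with
  | nil => simp
  | cons a w ih =>
    rw [invRev_cons_eq, wordVal_append, ih, wordVal_singleton, letterVal_letterInv, wordVal_cons,
      mul_inv_rev]

theorem vertex_le_iff {g : G} {Δ : CayleySubgraph ι} : vertex ι g ≤ Δ ↔ g ∈ Δ.verts :=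
  ⟨fun h => h.1 rfl, fun h => ⟨fun _ hk => hk ▸ h, fun _ hk => hk.elim⟩⟩

theorem edge_le_iff {g : G} {a : X × Bool} {Δ : CayleySubgraph ι} :
    edge ι g a ≤ Δ ↔ (g, a) ∈ Δ.edges := by
  refine ⟨fun h => h.2 (Or.inl rfl), fun h => ⟨?_, ?_⟩⟩
  · rintro _ (rfl | rfl)
    exacts [Δ.source_mem _ _ h, Δ.target_mem _ _ h]
  · rintro _ (rfl | rfl)
    exacts [h, Δ.inv_mem _ _ h]

theorem pathSpan_le_iff {g : G} {w : InvWord X} {Δ : CayleySubgraph ι} :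
    pathSpan ι g w ≤ Δ ↔ Δ.LabelsPath w g (g * wordVal ι w) := by
  induction w generalizing g with
  | nil => simp [pathSpan, LabelsPath, vertex_le_iff]
  | cons a w ih => rw [pathSpan, sup_le_iff, ih, edge_le_iff, LabelsPath, wordVal_cons, mul_assoc]

/-- Trades paths for inequalities in the lattice of subgraphs, where concatenation is a join and
reversal changes nothing. -/
theorem labelsPath_iff {g h : G} {w : InvWord X} {Δ : CayleySubgraph ι} :
    Δ.LabelsPath w g h ↔ pathSpan ι g w ≤ Δ ∧ g * wordVal ι w = h := by
  rw [pathSpan_le_iff]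
  refine ⟨fun hw => ?_, fun ⟨hw, e⟩ => e ▸ hw⟩
  have e : g * wordVal ι w = h := by
    induction w generalizing g with
    | nil => simpa using hw.2
    | cons a w ih => rw [wordVal_cons, ← mul_assoc]; exact ih hw.2
  exact ⟨e.symm ▸ hw, e⟩

/-- Links the geometry to the sets of prefixes in `wordVal_eq_of_prefixes`. -/
theorem mem_pathSpan_verts {g h : G} {w : InvWord X} :
    h ∈ (pathSpan ι g w).verts ↔ ∃ p, p <+: w ∧ g * wordVal ι p = h := by
  induction w generalizing g with
  | nil =>
    simp only [List.prefix_nil, exists_eq_left, wordVal_nil, mul_one]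
    exact eq_comm
  | cons a w ih =>
    change (h ∈ (edge ι g a).verts ∨ h ∈ (pathSpan ι (g * letterVal ι a) w).verts) ↔ _
    rw [ih]
    constructor
    · rintro ((rfl | rfl) | ⟨p, hp, rfl⟩)
      · exact ⟨[], List.nil_prefix, by simp⟩
      · exact ⟨[a], by simp, by rw [wordVal_singleton]⟩
      · exact ⟨a :: p, by simpa using hp, by rw [wordVal_cons, mul_assoc]⟩
    · rintro ⟨p, hp, rfl⟩
      rcases p with _ | ⟨b, p⟩
      · exact Or.inl (Or.inl (by simp))
      · rw [List.cons_prefix_cons] at hp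
        obtain ⟨rfl, hp⟩ := hp
        exact Or.inr ⟨p, hp, by rw [wordVal_cons, mul_assoc]⟩

theorem source_mem_pathSpan (g : G) (w : InvWord X) : g ∈ (pathSpan ι g w).verts :=
  mem_pathSpan_verts.2 ⟨[], List.nil_prefix, by simp⟩

theorem target_mem_pathSpan (g : G) (w : InvWord X) :
    g * wordVal ι w ∈ (pathSpan ι g w).verts :=
  mem_pathSpan_verts.2 ⟨w, List.prefix_rfl, rfl⟩

theorem pathSpan_append (g : G) (w z : InvWord X) :
    pathSpan ι g (w ++ z) = pathSpan ι g w ⊔ pathSpan ι (g * wordVal ι w) z := by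
  induction w generalizing g with
  | nil =>
    simp only [List.nil_append, wordVal_nil, mul_one, pathSpan]
    exact (sup_eq_right.2 (vertex_le_iff.2 (source_mem_pathSpan g z))).symm
  | cons a w ih => rw [List.cons_append, pathSpan, ih, pathSpan, wordVal_cons, mul_assoc, sup_assoc]

theorem edge_letterInv (g : G) (a : X × Bool) :
    edge ι (g * letterVal ι a) (letterInv a) = edge ι g a := by
  have h : ∀ (g : G) (a : X × Bool), edge ι (g * letterVal ι a) (letterInv a) ≤ edge ι g a :=
    fun g a => edge_le_iff.2 (Or.inr rfl)
  refine (h g a).antisymm ?_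
  have := h (g * letterVal ι a) (letterInv a)
  rwa [letterVal_letterInv, mul_inv_cancel_right, letterInv_letterInv] at this

theorem pathSpan_singleton (g : G) (a : X × Bool) : pathSpan ι g [a] = edge ι g a :=
  sup_eq_left.2 (vertex_le_iff.2 (Or.inr rfl))

theorem pathSpan_invRev (g : G) (w : InvWord X) :
    pathSpan ι (g * wordVal ι w) (FreeGroup.invRev w) = pathSpan ι g w := by
  induction w generalizing g with
  | nil => simp [pathSpan]
  | cons a w ih =>
    rw [invRev_cons_eq, wordVal_cons, ← mul_assoc, pathSpan_append, ih, wordVal_invRev_group,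
      mul_inv_cancel_right, pathSpan_singleton, edge_letterInv, pathSpan, sup_comm]

theorem smul_le_iff (k : G) (Δ Ξ : CayleySubgraph ι) : k • Δ ≤ Ξ ↔ Δ ≤ k⁻¹ • Ξ :=
  ⟨fun h => by simpa using smul_mono (g := k⁻¹) h, fun h => by simpa using smul_mono (g := k) h⟩

theorem smul_pathSpan (k g : G) (w : InvWord X) :
    k • pathSpan ι g w = pathSpan ι (k * g) w := by
  have h : ∀ (k g : G), pathSpan ι (k * g) w ≤ k • pathSpan ι g w := by
    intro k g
    induction w generalizing g with
    | nil => exact vertex_le_iff.2 (by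
        rw [mem_smul_verts, inv_mul_cancel_left]
        exact source_mem_pathSpan g [])
    | cons a w ih =>
      rw [pathSpan, pathSpan, smul_sup]
      refine sup_le_sup (edge_le_iff.2 ?_) ?_
      · rw [mem_smul_edges, inv_mul_cancel_left]
        exact Or.inl rfl
      · rw [mul_assoc]
        exact ih _
  -- The other inclusion is the one already shown, for the translation by `k⁻¹`.
  refine le_antisymm ?_ (h k g)
  have := h k⁻¹ (k * g)
  rw [inv_mul_cancel_left] at this
  exact (smul_le_iff _ _ _).2 this

theorem vertex_isFinite (g : G) : (vertex ι g).IsFinite :=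
  ⟨Set.finite_singleton _, Set.finite_empty⟩

theorem pathSpan_isFinite (g : G) (w : InvWord X) : (pathSpan ι g w).IsFinite := by
  induction w generalizing g with
  | nil => exact vertex_isFinite g
  | cons a w ih => exact IsFinite.sup ⟨Set.toFinite {_, _}, Set.toFinite {_, _}⟩ (ih _)

theorem IsFinite.mono {Δ Ξ : CayleySubgraph ι} (h : Ξ.IsFinite) (hle : Δ ≤ Ξ) : Δ.IsFinite :=
  ⟨h.1.subset hle.1, h.2.subset hle.2⟩

/-- A cancelling pair goes along an edge and straight back, so dropping it leaves the rest of the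
path in place. In the free group it follows that every path contains the geodesic between its ends.
-/
theorem pathSpan_le_of_red {w z : InvWord X} (h : FreeGroup.Red w z) (g : G) :
    pathSpan ι g z ≤ pathSpan ι g w := by
  induction h with
  | refl => exact le_rfl
  | tail _ h ih =>
    refine le_trans ?_ ih
    cases h with
    | @not L₁ L₂ x b =>
      rw [pathSpan_append, pathSpan_append]
      refine sup_le_sup le_rfl ?_
      have hx : letterVal ι (x, !b) = (letterVal ι (x, b))⁻¹ := letterVal_letterInv ι (x, b)
      rw [pathSpan, pathSpan, hx, mul_inv_cancel_right]
      exact le_sup_right.trans le_sup_right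

/-! ### Connected subgraphs -/

theorem connected_iff {Δ : CayleySubgraph ι} :
    Δ.Connected ↔ ∀ g ∈ Δ.verts, ∀ h ∈ Δ.verts, ∃ w, pathSpan ι g w ≤ Δ ∧ g * wordVal ι w = h := by
  simp only [Connected, labelsPath_iff]

/-- Two vertices are joined through `r`: back along the path to the first, then out to the second.
-/
theorem connected_of_root {Δ : CayleySubgraph ι} (r : G)
    (h : ∀ g ∈ Δ.verts, ∃ w, pathSpan ι r w ≤ Δ ∧ r * wordVal ι w = g) : Δ.Connected := by
  rw [connected_iff]
  intro g hg k hk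
  obtain ⟨w, hw, rfl⟩ := h g hg
  obtain ⟨z, hz, rfl⟩ := h k hk
  refine ⟨FreeGroup.invRev w ++ z, ?_, ?_⟩
  · rw [pathSpan_append, pathSpan_invRev, wordVal_invRev_group, mul_inv_cancel_right]
    exact sup_le hw hz
  · rw [wordVal_append, wordVal_invRev_group, mul_assoc, mul_inv_cancel_left]

theorem pathSpan_connected (g : G) (w : InvWord X) : (pathSpan ι g w).Connected := by
  refine connected_of_root g fun h hh => ?_
  obtain ⟨p, ⟨q, rfl⟩, rfl⟩ := mem_pathSpan_verts.1 hh
  exact ⟨p, by rw [pathSpan_append]; exact le_sup_left, rfl⟩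

theorem Connected.sup {Δ Ξ : CayleySubgraph ι} (h1 : Δ.Connected) (h2 : Ξ.Connected) {r : G}
    (hr1 : r ∈ Δ.verts) (hr2 : r ∈ Ξ.verts) : (Δ ⊔ Ξ).Connected := by
  rw [connected_iff] at h1 h2
  refine connected_of_root r fun g hg => ?_
  rcases hg with hg | hg
  · obtain ⟨w, hw, e⟩ := h1 r hr1 g hg
    exact ⟨w, hw.trans le_sup_left, e⟩
  · obtain ⟨w, hw, e⟩ := h2 r hr2 g hg
    exact ⟨w, hw.trans le_sup_right, e⟩

theorem Connected.smul {Δ : CayleySubgraph ι} (h : Δ.Connected) (k : G) : (k • Δ).Connected := by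
  rw [connected_iff] at h ⊢
  intro g hg l hl
  obtain ⟨w, hw, e⟩ := h _ hg _ hl
  refine ⟨w, ?_, ?_⟩
  · have := smul_mono (g := k) hw
    rwa [smul_pathSpan, mul_inv_cancel_left] at this
  · rwa [mul_assoc, mul_left_cancel_iff] at e

/-- A finite subgraph of a connected subgraph is covered by a closed path. -/
theorem Connected.exists_closed_path {Δ : CayleySubgraph ι} (h : Δ.Connected) {r : G}
    (hr : r ∈ Δ.verts) (hfin : Δ.IsFinite) :
    ∃ w, pathSpan ι r w = Δ ∧ wordVal ι w = 1 := by
  rw [connected_iff] at h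
  have hV : ∀ V : Set G, V.Finite → V ⊆ Δ.verts →
      ∃ w, pathSpan ι r w ≤ Δ ∧ wordVal ι w = 1 ∧ V ⊆ (pathSpan ι r w).verts := by
    intro V hV
    induction V, hV using Set.Finite.induction_on with
    | empty => exact fun _ => ⟨[], vertex_le_iff.2 hr, rfl, Set.empty_subset _⟩
    | @insert g V _ _ ih =>
      intro hs
      obtain ⟨w, hw, e, hwV⟩ := ih ((Set.subset_insert _ _).trans hs)
      obtain ⟨p, hp, rfl⟩ := h r hr g (hs (Set.mem_insert _ _))
      -- A detour to the new vertex and back, followed by the closed path already built.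
      refine ⟨p ++ FreeGroup.invRev p ++ w, ?_, ?_, ?_⟩
      · simp only [pathSpan_append, pathSpan_invRev, wordVal_append, wordVal_invRev_group,
          mul_inv_cancel, mul_one]
        exact sup_le (sup_le hp hp) hw
      · rw [wordVal_append, wordVal_append, wordVal_invRev_group, mul_inv_cancel, e, mul_one]
      · simp only [pathSpan_append, pathSpan_invRev, wordVal_append, wordVal_invRev_group,
          mul_inv_cancel, mul_one]
        rintro _ (rfl | hk)
        · exact Or.inl (Or.inl (target_mem_pathSpan r p))
        · exact Or.inr (hwV hk)
  have hE : ∀ E : Set (G × (X × Bool)), E.Finite → E ⊆ Δ.edges →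
      ∃ w, pathSpan ι r w ≤ Δ ∧ wordVal ι w = 1 ∧ E ⊆ (pathSpan ι r w).edges := by
    intro E hE
    induction E, hE using Set.Finite.induction_on with
    | empty => exact fun _ => ⟨[], vertex_le_iff.2 hr, rfl, Set.empty_subset _⟩
    | @insert d E _ _ ih =>
      intro hs
      obtain ⟨w, hw, e, hwE⟩ := ih ((Set.subset_insert _ _).trans hs)
      obtain ⟨g, a⟩ := d
      have ha := hs (Set.mem_insert _ _)
      obtain ⟨p, hp, rfl⟩ := h r hr g (Δ.source_mem _ _ ha)
      have hspan : pathSpan ι r (p ++ [a]) = pathSpan ι r p ⊔ edge ι (r * wordVal ι p) a := by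
        rw [pathSpan_append, pathSpan_singleton]
      -- The same detour, lengthened by the new edge.
      refine ⟨(p ++ [a]) ++ FreeGroup.invRev (p ++ [a]) ++ w, ?_, ?_, ?_⟩
      · rw [pathSpan_append, pathSpan_append r (p ++ [a]), pathSpan_invRev,
          wordVal_append _ (p ++ [a]), wordVal_invRev_group, mul_inv_cancel, mul_one, hspan]
        have := sup_le hp (edge_le_iff.2 ha)
        exact sup_le (sup_le this this) hw
      · rw [wordVal_append, wordVal_append _ (p ++ [a]), wordVal_invRev_group, mul_inv_cancel, e,
          mul_one]
      · rw [pathSpan_append, pathSpan_append r (p ++ [a]), pathSpan_invRev,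
          wordVal_append _ (p ++ [a]), wordVal_invRev_group, mul_inv_cancel, mul_one, hspan]
        rintro _ (rfl | hk)
        · exact Or.inl (Or.inl (Or.inr (Or.inl rfl)))
        · exact Or.inr (hwE hk)
  obtain ⟨w, hw, ew, hwV⟩ := hV _ hfin.1 subset_rfl
  obtain ⟨z, hz, ez, hzE⟩ := hE _ hfin.2 subset_rfl
  have hspan : pathSpan ι r (w ++ z) = pathSpan ι r w ⊔ pathSpan ι r z := by
    rw [pathSpan_append, ew, mul_one]
  refine ⟨w ++ z, ?_, by rw [wordVal_append, ew, ez, mul_one]⟩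
  rw [hspan]
  exact (sup_le hw hz).antisymm ⟨fun _ hk => Or.inl (hwV hk), fun _ hk => Or.inr (hzE hk)⟩

/-- After a closed path covering `Δ`, a path inside `Δ` to `g` adds nothing to the span. This gives
surjectivity onto Munn's model. -/
theorem Connected.exists_pathSpan_eq {Δ : CayleySubgraph ι} (h : Δ.Connected) {r g : G}
    (hr : r ∈ Δ.verts) (hg : g ∈ Δ.verts) (hfin : Δ.IsFinite) :
    ∃ w, pathSpan ι r w = Δ ∧ r * wordVal ι w = g := by
  obtain ⟨w, hw, ew⟩ := h.exists_closed_path hr hfin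
  obtain ⟨p, hp, rfl⟩ := connected_iff.1 h r hr g hg
  refine ⟨w ++ p, ?_, by rw [wordVal_append, ew, one_mul]⟩
  rw [pathSpan_append, ew, mul_one, hw]
  exact sup_eq_left.2 hp

/-- Over a generating set, a finite subgraph is contained in a finite connected subgraph. -/
theorem IsFinite.exists_connected (hι : ∀ g : G, ∃ w, wordVal ι w = g) {Δ : CayleySubgraph ι}
    (h : Δ.IsFinite) : ∃ Ξ : CayleySubgraph ι, Δ ≤ Ξ ∧ Ξ.IsFinite ∧ Ξ.Connected := by
  have hV : ∀ V : Set G, V.Finite → ∃ Ξ : CayleySubgraph ι, V ⊆ Ξ.verts ∧ Ξ.IsFinite ∧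
      Ξ.Connected ∧ 1 ∈ Ξ.verts := by
    intro V hV
    induction V, hV using Set.Finite.induction_on with
    | empty =>
      exact ⟨pathSpan ι 1 [], Set.empty_subset _, pathSpan_isFinite _ _, pathSpan_connected _ _,
        source_mem_pathSpan _ _⟩
    | @insert g V _ _ ih =>
      obtain ⟨Ξ, h1, h2, h3, h4⟩ := ih
      obtain ⟨w, rfl⟩ := hι g
      refine ⟨Ξ ⊔ pathSpan ι 1 w, ?_, h2.sup (pathSpan_isFinite _ _),
        h3.sup (pathSpan_connected _ _) h4 (source_mem_pathSpan _ _), Or.inl h4⟩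
      rintro _ (rfl | hk)
      · exact Or.inr (by simpa using target_mem_pathSpan (ι := ι) 1 w)
      · exact Or.inl (h1 hk)
  obtain ⟨Ξ, h1, h2, h3, h4⟩ := hV _ h.1
  -- `Ξ` already contains the vertices of `Δ`, so joining `Δ` adds only edges and preserves
  -- connectedness.
  refine ⟨Ξ ⊔ Δ, le_sup_right, h2.sup h, connected_of_root 1 fun g hg => ?_⟩
  obtain ⟨w, hw, e⟩ := connected_iff.1 h3 1 h4 g (hg.elim id fun hg => h1 hg)
  exact ⟨w, hw.trans le_sup_left, e⟩

/-! ### Closed subgraphs -/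

theorem labelsJourney_ofWord {Δ : CayleySubgraph ι} {w : InvWord X} {g h : G} :
    Δ.LabelsJourney (ImTerm.ofWord w) g h ↔ Δ.LabelsPath w g h := by
  induction w generalizing g with
  | nil => rfl
  | cons a w ih => exact and_congr Iff.rfl ih

theorem labelsJourney_maxWord {Δ : CayleySubgraph ι} {w : InvWord X} {g h : G} :
    Δ.LabelsJourney (ImTerm.maxWord w) g h ↔
      g ∈ Δ.verts ∧ g * wordVal ι w ∈ Δ.verts ∧ g * wordVal ι w = h := Iff.rfl

end CayleySubgraph

open CayleySubgraph

/-! ### The closure operator of the presentation on the Cayley tree. -/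

section RedClosure

variable {X : Type u}

/-- If `w` represents `g⁻¹ k`, then `w^𝔪` jumps from `g` to `k` using no edge, so in a closed
subgraph `red w` labels a path joining them. Conversely, a connected subgraph contains some path `z`
between the two vertices; `red z = red w`, and the path of `z` contains that of `red z`. -/
theorem redClosure_isClosed_iff {Δ : CayleySubgraph (FreeGroup.of : X → FreeGroup X)} :
    (redClosure X).op.IsClosed Δ ↔ Δ.Connected := by
  change Δ.RelClosed (redRel X) ↔ _
  rw [connected_iff]
  constructor
  · intro h g hg k hk
    obtain ⟨w, hw⟩ := Quot.exists_rep (g⁻¹ * k)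
    have hw : FreeGroup.mk w = g⁻¹ * k := hw
    refine ⟨red w, ?_⟩
    rw [← labelsPath_iff, ← labelsJourney_ofWord]
    refine (h _ _ ⟨w, rfl, rfl⟩ g hg k hk).2 (labelsJourney_maxWord.2 ?_)
    rw [wordVal_freeGroup, hw, mul_inv_cancel_left]
    exact ⟨hg, hk, rfl⟩
  · rintro h _ _ ⟨w, rfl, rfl⟩ g hg k hk
    rw [labelsJourney_ofWord, labelsJourney_maxWord, labelsPath_iff, wordVal_freeGroup,
      wordVal_freeGroup, mk_red]
    constructor
    · rintro ⟨_, rfl⟩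
      exact ⟨hg, hk, rfl⟩
    · rintro ⟨_, _, rfl⟩
      refine ⟨?_, rfl⟩
      obtain ⟨z, hz, e⟩ := h g hg _ hk
      rw [wordVal_freeGroup, mul_left_cancel_iff] at e
      rw [← red_eq_iff.2 e]
      exact (pathSpan_le_of_red (red_red z) g).trans hz

theorem exists_wordVal_eq (g : FreeGroup X) : ∃ w, wordVal FreeGroup.of w = g := by
  obtain ⟨w, rfl⟩ := Quot.exists_rep g
  exact ⟨w, wordVal_freeGroup w⟩

/-- The closure of a finite subgraph stays finite because it lies in any finite connected subgraph
above it. -/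
theorem isCompactSubgraph_redClosure_iff {Δ : CayleySubgraph (FreeGroup.of : X → FreeGroup X)} :
    IsCompactSubgraph (redClosure X) Δ ↔ Δ.IsFinite ∧ Δ.Connected := by
  constructor
  · rintro ⟨F, hF, rfl⟩
    refine ⟨?_, redClosure_isClosed_iff.1 ((redClosure X).op.isClosed_closure F)⟩
    obtain ⟨Ξ, h1, h2, h3⟩ := hF.exists_connected exists_wordVal_eq
    exact h2.mono (ClosureOperator.closure_min h1 (redClosure_isClosed_iff.2 h3))
  · rintro ⟨h1, h2⟩
    exact ⟨Δ, h1, (redClosure_isClosed_iff.2 h2).closure_eq.symm⟩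

/-- The geodesic is the least connected subgraph through both vertices. Hence `𝔪` in the model is
free reduction, as `ofWord_red` records. -/
theorem redClosure_pair (w : InvWord X) :
    (redClosure X).op (vertex FreeGroup.of 1 ⊔ vertex FreeGroup.of (FreeGroup.mk w)) =
      pathSpan FreeGroup.of 1 (red w) := by
  refine le_antisymm (ClosureOperator.closure_min (sup_le (vertex_le_iff.2 ?_)
    (vertex_le_iff.2 ?_)) (redClosure_isClosed_iff.2 (pathSpan_connected _ _))) ?_
  · exact source_mem_pathSpan _ _
  · have := target_mem_pathSpan (ι := (FreeGroup.of : X → FreeGroup X)) 1 (red w)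
    rwa [wordVal_freeGroup, mk_red, one_mul] at this
  · set C := (redClosure X).op (vertex FreeGroup.of 1 ⊔ vertex FreeGroup.of (FreeGroup.mk w))
    have hle := (redClosure X).op.le_closure
      (vertex FreeGroup.of 1 ⊔ vertex FreeGroup.of (FreeGroup.mk w))
    have hC : C.Connected := redClosure_isClosed_iff.1 ((redClosure X).op.isClosed_closure _)
    obtain ⟨z, hz, e⟩ := connected_iff.1 hC 1 (hle.1 (Or.inl rfl)) _ (hle.1 (Or.inr rfl))
    rw [wordVal_freeGroup, one_mul] at e
    rw [← red_eq_iff.2 e]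
    exact (pathSpan_le_of_red (red_red z) 1).trans hz

/-! ### Munn's model and the Munn trees of words. -/

namespace ClosureMonoid

theorem graph_isFinite (s : ClosureMonoid (redClosure X)) : s.graph.IsFinite :=
  (isCompactSubgraph_redClosure_iff.1 s.compact).1

theorem graph_connected (s : ClosureMonoid (redClosure X)) : s.graph.Connected :=
  (isCompactSubgraph_redClosure_iff.1 s.compact).2

/-- The two connected pieces share the vertex `s.elt`, so their union is already closed. -/
theorem graph_mul (s t : ClosureMonoid (redClosure X)) :
    (s * t).graph = s.graph ⊔ s.elt • t.graph := by
  refine (redClosure_isClosed_iff.2 (s.graph_connected.sup (t.graph_connected.smul _)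
    s.elt_mem ?_)).closure_eq
  rw [mem_smul_verts, inv_mul_cancel]
  exact t.one_mem

theorem elt_mul (s t : ClosureMonoid (redClosure X)) : (s * t).elt = s.elt * t.elt := rfl

theorem exists_iff (Δ : CayleySubgraph (FreeGroup.of : X → FreeGroup X)) (g : FreeGroup X) :
    (∃ s : ClosureMonoid (redClosure X), s.graph = Δ ∧ s.elt = g) ↔
      Δ.IsFinite ∧ Δ.Connected ∧ 1 ∈ Δ.verts ∧ g ∈ Δ.verts := by
  constructor
  · rintro ⟨s, rfl, rfl⟩
    exact ⟨s.graph_isFinite, s.graph_connected, s.one_mem, s.elt_mem⟩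
  · rintro ⟨h1, h2, h3, h4⟩
    exact ⟨⟨Δ, g, isCompactSubgraph_redClosure_iff.2 ⟨h1, h2⟩, h3, h4⟩, rfl, rfl⟩

/-- The Munn tree of a word: the subgraph spanned by its path from `1`, with the end point. -/
def ofWord (w : InvWord X) : ClosureMonoid (redClosure X) where
  graph := pathSpan FreeGroup.of 1 w
  elt := FreeGroup.mk w
  compact := isCompactSubgraph_redClosure_iff.2 ⟨pathSpan_isFinite _ _, pathSpan_connected _ _⟩
  one_mem := source_mem_pathSpan _ _
  elt_mem := by
    have := target_mem_pathSpan (ι := (FreeGroup.of : X → FreeGroup X)) 1 w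
    rwa [wordVal_freeGroup, one_mul] at this

theorem ofWord_append (w z : InvWord X) : ofWord (w ++ z) = ofWord w * ofWord z := by
  apply ClosureMonoid.ext
  · rw [graph_mul]
    change pathSpan _ _ _ = pathSpan _ _ _ ⊔ FreeGroup.mk w • pathSpan _ _ _
    rw [pathSpan_append, smul_pathSpan, wordVal_freeGroup, one_mul, mul_one]
  · rfl

theorem ofWord_invRev (w : InvWord X) : ofWord (FreeGroup.invRev w) = (ofWord w)⁻¹ := by
  apply ClosureMonoid.ext
  · change pathSpan _ _ _ = (FreeGroup.mk w)⁻¹ • pathSpan _ _ _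
    rw [smul_pathSpan, ← pathSpan_invRev _ w, wordVal_freeGroup, mul_one, inv_mul_cancel]
  · rfl

theorem ofWord_surjective : Function.Surjective (ofWord (X := X)) := by
  intro s
  obtain ⟨w, hw, e⟩ := s.graph_connected.exists_pathSpan_eq s.one_mem s.elt_mem s.graph_isFinite
  rw [wordVal_freeGroup, one_mul] at e
  exact ⟨w, ClosureMonoid.ext hw e⟩

theorem ofWord_red (w : InvWord X) : ofWord (red w) = (ofWord w).maxi :=
  ClosureMonoid.ext (redClosure_pair w).symm (mk_red w)

theorem ofWord_regular (w : InvWord X) :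
    ofWord (w ++ FreeGroup.invRev w ++ w) = ofWord w := by
  apply ClosureMonoid.ext
  · change pathSpan _ _ _ = pathSpan _ _ _
    simp only [pathSpan_append, pathSpan_invRev, wordVal_append, wordVal_invRev_group,
      mul_inv_cancel, mul_one, sup_idem]
  · change FreeGroup.mk _ = FreeGroup.mk _
    simp [← FreeGroup.mul_mk, ← FreeGroup.inv_mk]

theorem ofWord_comm (w z : InvWord X) :
    ofWord (w ++ FreeGroup.invRev w ++ (z ++ FreeGroup.invRev z)) =
      ofWord (z ++ FreeGroup.invRev z ++ (w ++ FreeGroup.invRev w)) := by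
  apply ClosureMonoid.ext
  · change pathSpan _ _ _ = pathSpan _ _ _
    simp only [pathSpan_append, pathSpan_invRev, wordVal_append, wordVal_invRev_group,
      mul_inv_cancel, mul_one, sup_idem]
    exact sup_comm _ _
  · change FreeGroup.mk _ = FreeGroup.mk _
    simp [← FreeGroup.mul_mk, ← FreeGroup.inv_mk]

/-- The injectivity half of Munn's theorem, obtained by taking the free inverse monoid for `M`. Only
the end points and the vertex sets of the trees are compared. -/
theorem wordVal_eq_of_ofWord_eq {M : Type*} [InverseMonoid M] (ι : X → M) {w z : InvWord X}
    (h : ofWord w = ofWord z) : wordVal ι w = wordVal ι z := by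
  refine wordVal_eq_of_prefixes ι (congrArg ClosureMonoid.elt h) ?_
  have hv : ∀ w : InvWord X, {g | ∃ p, p <+: w ∧ FreeGroup.mk p = g} = (ofWord w).graph.verts := by
    intro w
    ext g
    change _ ↔ g ∈ (pathSpan _ _ _).verts
    simp [mem_pathSpan_verts, wordVal_freeGroup]
  rw [hv, hv, h]

end ClosureMonoid

end RedClosure

/-! ## The free inverse monoid and Munn's model -/

namespace FreeInverseMonoid

variable {X : Type u}

theorem wordVal_of (w : InvWord X) : wordVal of w = mk w := by
  induction w with
  | nil => rfl
  | cons a w ih =>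
    rw [wordVal_cons, ih, ← List.singleton_append, ← mk_mul]
    rcases a with ⟨x, _ | _⟩ <;> rfl

/-- A function on words that is compatible with products and with the defining relations
is constant on the classes of the Vagner congruence. -/
theorem eq_of_rel {T : Type v} [Mul T] (f : InvWord X → T)
    (hmul : ∀ w z, f (w ++ z) = f w * f z)
    (hf : ∀ a b, VagnerRel X a b → f a.toList = f b.toList) {a b : FreeMonoid (X × Bool)}
    (h : ConGen.Rel (VagnerRel X) a b) : f a.toList = f b.toList := by
  induction h with
  | of _ _ h => exact hf _ _ h
  | refl _ => rfl
  | symm _ ih => exact ih.symm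
  | trans _ _ ih1 ih2 => exact ih1.trans ih2
  | mul _ _ ih1 ih2 => rw [FreeMonoid.toList_mul, FreeMonoid.toList_mul, hmul, hmul, ih1, ih2]

/-- The homomorphism from the free inverse monoid extending a map of the generators. -/
def lift {M : Type v} [InverseMonoid M] (ι : X → M) : FreeInverseMonoid X →* M where
  toFun := Quotient.lift (fun a => wordVal ι a.toList) fun _ _ h =>
    eq_of_rel (wordVal ι) (wordVal_append ι) (by
      rintro _ _ (w | ⟨w, z⟩) <;>
        simp only [FreeMonoid.toList_ofList, wordVal_append, wordVal_invRev]
      · exact mul_inv_mul' _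
      · exact comm_rr _ _) h
  map_one' := rfl
  map_mul' := ind fun w => ind fun z => wordVal_append ι w z

theorem lift_mk {M : Type v} [InverseMonoid M] (ι : X → M) (w : InvWord X) :
    lift ι (mk w) = wordVal ι w := rfl

theorem lift_inv {M : Type v} [InverseMonoid M] (ι : X → M) :
    ∀ s, lift ι s⁻¹ = (lift ι s)⁻¹ :=
  ind fun w => by rw [mk_inv, lift_mk, lift_mk, wordVal_invRev]

/-- The homomorphism to Munn's model. -/
def munnHom : FreeInverseMonoid X →ₙ* ClosureMonoid (redClosure X) where
  -- Associativity of the model is not needed: `eq_of_rel` asks only for a multiplication.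
  toFun := Quotient.lift (fun a => ClosureMonoid.ofWord a.toList) fun _ _ h =>
    eq_of_rel ClosureMonoid.ofWord ClosureMonoid.ofWord_append (by
      rintro _ _ (w | ⟨w, z⟩)
      · exact ClosureMonoid.ofWord_regular w
      · exact ClosureMonoid.ofWord_comm w z) h
  map_mul' := ind fun w => ind fun z => ClosureMonoid.ofWord_append w z

theorem munnHom_bijective : Function.Bijective (munnHom (X := X)) := by
  constructor
  · refine ind fun w => ind fun z h => ?_
    rw [← wordVal_of, ← wordVal_of]
    exact ClosureMonoid.wordVal_eq_of_ofWord_eq of h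
  · intro s
    obtain ⟨w, rfl⟩ := ClosureMonoid.ofWord_surjective s
    exact ⟨mk w, rfl⟩

/-- Munn's isomorphism. -/
def munnEquiv (X : Type u) : FreeInverseMonoid X ≃* ClosureMonoid (redClosure X) :=
  MulEquiv.ofBijective munnHom munnHom_bijective

theorem munnEquiv_mk (w : InvWord X) : munnEquiv X (mk w) = ClosureMonoid.ofWord w := rfl

theorem munnEquiv_inv : ∀ s, munnEquiv X s⁻¹ = (munnEquiv X s)⁻¹ :=
  ind fun w => by rw [mk_inv, munnEquiv_mk, munnEquiv_mk, ClosureMonoid.ofWord_invRev]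

/-! ### The `σ`-classes of the free inverse monoid and their greatest elements. -/

theorem elt_munnEquiv_eq_of_natLE {s t : FreeInverseMonoid X} (h : NatLE s t) :
    (munnEquiv X s).elt = (munnEquiv X t).elt := by
  unfold NatLE at h
  rw [h, map_mul, map_mul, munnEquiv_inv, ClosureMonoid.elt_mul, ClosureMonoid.elt_mul]
  change _ * (_)⁻¹ * _ = _
  rw [mul_inv_cancel, one_mul]

theorem elt_munnEquiv_eq_of_sigma {s t : FreeInverseMonoid X} (h : Sigma s t) :
    (munnEquiv X s).elt = (munnEquiv X t).elt := by
  obtain ⟨c, h1, h2⟩ := h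
  rw [← elt_munnEquiv_eq_of_natLE h1, elt_munnEquiv_eq_of_natLE h2]

/-- All words of a `σ`-class have the same value in the free group, hence the same reduced form, and
each lies below it. -/
theorem isSigmaGreatest_red (w : InvWord X) : IsSigmaGreatest (mk w) (mk (red w)) := by
  have hle : ∀ w : InvWord X, NatLE (mk w) (mk (red w)) := fun w => by
    simpa only [wordVal_of] using wordVal_le_of_red of (red_red w)
  refine ⟨⟨mk w, NatLE.refl _, hle w⟩, ind fun z h => ?_⟩
  have e : FreeGroup.mk w = FreeGroup.mk z := elt_munnEquiv_eq_of_sigma h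
  rw [red_eq_iff.2 e]
  exact hle z

theorem exists_isSigmaGreatest : ∀ s : FreeInverseMonoid X, ∃ m, IsSigmaGreatest s m :=
  ind fun w => ⟨_, isSigmaGreatest_red w⟩

instance : FInverseMonoid (FreeInverseMonoid X) where
  maxi s := (exists_isSigmaGreatest s).choose
  isSigmaGreatest_maxi s := (exists_isSigmaGreatest s).choose_spec

/-- A greatest element is unique by antisymmetry, so the choice made in the instance is harmless. -/
theorem maxi_mk (w : InvWord X) : maxi (mk w) = mk (red w) := by
  have h1 := isSigmaGreatest_maxi (mk w)
  have h2 := isSigmaGreatest_red w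
  exact (h2.2 _ h1.1).antisymm (h1.2 _ h2.1)

end FreeInverseMonoid

/-! ## The presented F-inverse monoid -/

section Values

variable {X : Type u} {M : Type v} [Monoid M] [Inv M] (m : M → M) (ι : X → M) (w : InvWord X)

theorem ImTerm.val_ofWord : (ImTerm.ofWord w).val m ι = wordVal ι w := by
  simp [ImTerm.val, ImTerm.ofWord, wordVal, Function.comp_def]

theorem ImTerm.val_maxWord : (ImTerm.maxWord w).val m ι = m (wordVal ι w) := by
  simp [ImTerm.val, ImTerm.maxWord]

end Values

/-- A homomorphism of F-inverse monoids compatible with a relation factors through the quotient. -/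
def FQuotient.lift {M : Type u} {N : Type v} [FInverseMonoid M] [FInverseMonoid N]
    (r : M → M → Prop) (f : M →* N) (hinv : ∀ s, f s⁻¹ = (f s)⁻¹)
    (hmaxi : ∀ s, f (maxi s) = maxi (f s)) (hr : ∀ a b, r a b → f a = f b) :
    FQuotient r →* N where
  toFun := Quotient.lift f fun a b h => by
    change FCongGen r a b at h
    induction h with
    | of h => exact hr _ _ h
    | refl _ => rfl
    | symm _ ih => exact ih.symm
    | trans _ _ ih1 ih2 => exact ih1.trans ih2
    | mul _ _ ih1 ih2 => rw [map_mul, map_mul, ih1, ih2]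
    | inv _ ih => rw [hinv, hinv, ih]
    | maxi _ ih => rw [hmaxi, hmaxi, ih]
  map_one' := map_one f
  map_mul' := by
    rintro ⟨a⟩ ⟨b⟩
    exact map_mul f a b

/-- The projection to the quotient as a homomorphism. -/
def FQuotient.mkHom {M : Type u} [FInverseMonoid M] (r : M → M → Prop) : M →* FQuotient r where
  toFun := FQuotient.mk r
  map_one' := rfl
  map_mul' _ _ := rfl

variable {X : Type u}

/-- The defining relations, carried from the free F-inverse monoid to its quotient; all that is used
of them in building the inverse homomorphism. -/
theorem FInvPres.maxi_wordVal (w : InvWord X) :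
    maxi (wordVal (FInvPres.of (redRel X)) w) = wordVal (FInvPres.of (redRel X)) (red w) := by
  have h : FQuotient.mkHom (termRel (redRel X)) (wordVal FreeFInverseMonoid.of (red w)) =
      FQuotient.mkHom (termRel (redRel X)) (maxi (wordVal FreeFInverseMonoid.of w)) :=
    Quotient.sound (.of ⟨_, _, ⟨w, rfl, rfl⟩, (ImTerm.val_ofWord _ _ _).symm,
      (ImTerm.val_maxWord _ _ _).symm⟩)
  have hw : ∀ w, FQuotient.mkHom (termRel (redRel X)) (wordVal FreeFInverseMonoid.of w) =
      wordVal (FInvPres.of (redRel X)) w :=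
    map_wordVal _ (FQuotient.mkHom (termRel (redRel X))) fun _ => rfl
  rw [← hw, ← hw, h]
  rfl

/-- The homomorphism given by freeness factors through the quotient because `maxi_mk` is exactly the
defining relation in the free inverse monoid. -/
theorem FInvPres.exists_hom (X : Type u) : ∃ φ : FInvPres (redRel X) →* FreeInverseMonoid X,
    (∀ x, φ (FInvPres.of (redRel X) x) = FreeInverseMonoid.of x) ∧
    (∀ s, φ s⁻¹ = (φ s)⁻¹) ∧ (∀ s, φ (maxi s) = maxi (φ s)) := by
  obtain ⟨f, ⟨hinv, hmaxi, hof⟩, -⟩ :=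
    FreeFInverseMonoid.existsUnique_lift (FreeInverseMonoid.of : X → FreeInverseMonoid X)
  have hw : ∀ w, f (wordVal FreeFInverseMonoid.of w) = FreeInverseMonoid.mk w := fun w => by
    rw [map_wordVal _ f hinv, funext hof]
    exact FreeInverseMonoid.wordVal_of w
  refine ⟨FQuotient.lift _ f hinv hmaxi ?_, hof, ?_, ?_⟩
  · rintro _ _ ⟨_, _, ⟨w, rfl, rfl⟩, rfl, rfl⟩
    rw [ImTerm.val_ofWord, ImTerm.val_maxWord, hmaxi, hw, hw, FreeInverseMonoid.maxi_mk]
  · rintro ⟨a⟩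
    exact hinv a
  · rintro ⟨a⟩
    exact hmaxi a

/-- The homomorphism back comes from freeness among inverse monoids only, so its compatibility with
`𝔪` has to be checked on words. -/
theorem FInvPres.lift_of_maxi : ∀ s : FreeInverseMonoid X,
    FreeInverseMonoid.lift (FInvPres.of (redRel X)) (maxi s) =
      maxi (FreeInverseMonoid.lift (FInvPres.of (redRel X)) s) :=
  FreeInverseMonoid.ind fun w => by
    rw [FreeInverseMonoid.maxi_mk, FreeInverseMonoid.lift_mk, FreeInverseMonoid.lift_mk,
      FInvPres.maxi_wordVal]

/-- The canonical isomorphism between the presented F-inverse monoid and the free inverse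
monoid. -/
theorem FInvPres.exists_mulEquiv (X : Type u) :
    ∃ φ : FInvPres (redRel X) ≃* FreeInverseMonoid X,
      (∀ x, φ (FInvPres.of (redRel X) x) = FreeInverseMonoid.of x) ∧
      (∀ s, φ s⁻¹ = (φ s)⁻¹) ∧ (∀ s, φ (maxi s) = maxi (φ s)) := by
  obtain ⟨φ, hof, hinv, hmaxi⟩ := FInvPres.exists_hom X
  let β := FreeInverseMonoid.lift (FInvPres.of (redRel X))
  have hβof : ∀ x, β (FreeInverseMonoid.of x) = FInvPres.of (redRel X) x := fun x =>
    wordVal_singleton _ (x, true)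
  have h1 : φ.comp β = MonoidHom.id _ := by
    ext s
    induction s using FreeInverseMonoid.ind with
    | h w =>
      change φ (wordVal _ w) = FreeInverseMonoid.mk w
      rw [map_wordVal _ φ hinv, funext hof]
      exact FreeInverseMonoid.wordVal_of w
  have h2 : β.comp φ = MonoidHom.id _ := by
    let π := FQuotient.mkHom (termRel (redRel X))
    -- Both sides are homomorphisms of F-inverse monoids on the free one with the same values on
    -- generators, so uniqueness of the extension applies. Surjectivity of `π` then removes it.
    have key : (β.comp φ).comp π = π := by
      refine (FreeFInverseMonoid.existsUnique_lift (FInvPres.of (redRel X))).unique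
        ⟨fun s => ?_, fun s => ?_, fun x => ?_⟩ ⟨fun _ => rfl, fun _ => rfl, fun _ => rfl⟩
      · change β (φ (π s)⁻¹) = (β (φ (π s)))⁻¹
        rw [hinv, FreeInverseMonoid.lift_inv]
      · change β (φ (maxi (π s))) = maxi (β (φ (π s)))
        rw [hmaxi, FInvPres.lift_of_maxi]
      · exact (congrArg β (hof x)).trans (hβof x)
    ext ⟨a⟩
    exact DFunLike.congr_fun key a
  exact ⟨φ.toMulEquiv β h2 h1, hof, hinv, hmaxi⟩

/-! ### The greatest group image: the end point of the Munn tree as a complete invariant of the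
`σ`-class. -/

theorem FInvPres.exists_groupImage_equiv (X : Type u) :
    ∃ f : GroupImage (FInvPres (redRel X)) ≃* FreeGroup X,
      ∀ x, f (sigmaMk (FInvPres.of (redRel X) x)) = FreeGroup.of x := by
  obtain ⟨φ, hof, hinv, hmaxi⟩ := FInvPres.exists_mulEquiv X
  have hsigma : ∀ s t, Sigma s t → Sigma (φ s) (φ t) := by
    have hle : ∀ s t, NatLE s t → NatLE (φ s) (φ t) := fun s t h => by
      unfold NatLE at *
      rw [← hinv, ← map_mul, ← map_mul, ← h]
    exact fun s t ⟨c, h1, h2⟩ => ⟨φ c, hle _ _ h1, hle _ _ h2⟩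
  let g : GroupImage (FInvPres (redRel X)) →ₙ* FreeGroup X :=
    { toFun := Quotient.lift (fun s => (FreeInverseMonoid.munnEquiv X (φ s)).elt)
        fun s t h => FreeInverseMonoid.elt_munnEquiv_eq_of_sigma (hsigma s t h)
      map_mul' := by
        rintro ⟨s⟩ ⟨t⟩
        change (FreeInverseMonoid.munnEquiv X (φ (s * t))).elt = _
        rw [map_mul, map_mul]
        rfl }
  have hg : ∀ w, g (sigmaMk (φ.symm (FreeInverseMonoid.mk w))) = FreeGroup.mk w := fun w => by
    change (FreeInverseMonoid.munnEquiv X (φ (φ.symm _))).elt = _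
    rw [MulEquiv.apply_symm_apply]
    rfl
  refine ⟨MulEquiv.ofBijective g ⟨?_, fun k => ?_⟩, fun x => ?_⟩
  · rintro ⟨s⟩ ⟨t⟩ h
    obtain ⟨s, rfl⟩ := φ.symm.surjective s
    obtain ⟨t, rfl⟩ := φ.symm.surjective t
    induction s using FreeInverseMonoid.ind with
    | h w =>
      induction t using FreeInverseMonoid.ind with
      | h z =>
        have e : FreeGroup.mk w = FreeGroup.mk z := (hg w).symm.trans (h.trans (hg z))
        -- Equal end points give equal reduced words, hence equal greatest elements, and each
        -- element is `σ`-related to its own.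
        have hm : maxi (φ.symm (FreeInverseMonoid.mk w)) =
            maxi (φ.symm (FreeInverseMonoid.mk z)) := by
          apply φ.injective
          rw [hmaxi, hmaxi, φ.apply_symm_apply, φ.apply_symm_apply, FreeInverseMonoid.maxi_mk,
            FreeInverseMonoid.maxi_mk, red_eq_iff.2 e]
        refine Quotient.sound (s := (sigmaCon _).toSetoid) ?_
        have h1 := (isSigmaGreatest_maxi (φ.symm (FreeInverseMonoid.mk w))).1
        rw [hm] at h1
        exact h1.trans (isSigmaGreatest_maxi _).1.symm
  · obtain ⟨w, rfl⟩ := Quot.exists_rep k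
    exact ⟨_, hg w⟩
  · change (FreeInverseMonoid.munnEquiv X (φ (FInvPres.of (redRel X) x))).elt = _
    rw [hof]
    rfl

end

theorem mainTheorem7 (X : Type*) :
    -- the free inverse monoid is F-inverse, the greatest element above `w` being `red w`
    (∀ s : FreeInverseMonoid X, ∃ m, InverseMonoid.IsSigmaGreatest s m) ∧
    (∀ w : InvWord X, InverseMonoid.IsSigmaGreatest (wordVal FreeInverseMonoid.of w)
      (wordVal FreeInverseMonoid.of (red w))) ∧
    -- canonical isomorphism of F-inverse monoids between the presented monoid and `FIM(X)`
    (∃ φ : FInvPres (redRel X) ≃* FreeInverseMonoid X,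
      (∀ x, φ (FInvPres.of (redRel X) x) = FreeInverseMonoid.of x) ∧
      (∀ s, φ s⁻¹ = (φ s)⁻¹) ∧
      (∀ s, InverseMonoid.IsSigmaGreatest (φ s) (φ (FInverseMonoid.maxi s)))) ∧
    -- the greatest group image of the presented monoid is the free group
    (∃ f : InverseMonoid.GroupImage (FInvPres (redRel X)) ≃* FreeGroup X,
      ∀ x, f (InverseMonoid.sigmaMk (FInvPres.of (redRel X) x)) = FreeGroup.of x) ∧
    -- closed subgraphs are exactly the connected subgraphs
    (∀ Δ : CayleySubgraph (FreeGroup.of : X → FreeGroup X),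
      (redClosure X).op.IsClosed Δ ↔ Δ.Connected) ∧
    -- the monoid of the closure operator is Munn's model
    (∀ (Δ : CayleySubgraph (FreeGroup.of : X → FreeGroup X)) (g : FreeGroup X),
      (∃ s : ClosureMonoid (redClosure X), s.graph = Δ ∧ s.elt = g) ↔
        Δ.IsFinite ∧ Δ.Connected ∧ 1 ∈ Δ.verts ∧ g ∈ Δ.verts) ∧
    (∀ s t : ClosureMonoid (redClosure X),
      (s * t).graph = s.graph ⊔ s.elt • t.graph ∧ (s * t).elt = s.elt * t.elt) ∧
    (∃ ψ : FreeInverseMonoid X ≃* ClosureMonoid (redClosure X),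
      (∀ s, ψ s⁻¹ = (ψ s)⁻¹) ∧
      (∀ w : InvWord X,
        (ψ (wordVal FreeInverseMonoid.of w)).graph =
          CayleySubgraph.pathSpan FreeGroup.of 1 w ∧
        (ψ (wordVal FreeInverseMonoid.of w)).elt = FreeGroup.mk w)) ∧
    (∃ θ : FInvPres (redRel X) ≃* ClosureMonoid (redClosure X),
      (∀ x, (θ (FInvPres.of (redRel X) x)).graph =
          (redClosure X).op (CayleySubgraph.edge FreeGroup.of 1 (x, true)) ∧
        (θ (FInvPres.of (redRel X) x)).elt = FreeGroup.of x) ∧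
      (∀ s, θ s⁻¹ = (θ s)⁻¹) ∧
      (∀ s, θ (FInverseMonoid.maxi s) = (θ s).maxi)) := by
  obtain ⟨φ, hof, hinv, hmaxi⟩ := FInvPres.exists_mulEquiv X
  refine ⟨FreeInverseMonoid.exists_isSigmaGreatest, fun w => ?_, ⟨φ, hof, hinv, fun s => ?_⟩,
    FInvPres.exists_groupImage_equiv X, fun Δ => redClosure_isClosed_iff,
    ClosureMonoid.exists_iff, fun s t => ⟨ClosureMonoid.graph_mul s t, rfl⟩,
    ⟨FreeInverseMonoid.munnEquiv X, FreeInverseMonoid.munnEquiv_inv, fun w => ?_⟩,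
    ⟨φ.trans (FreeInverseMonoid.munnEquiv X), fun x => ?_, fun s => ?_, fun s => ?_⟩⟩
  · rw [FreeInverseMonoid.wordVal_of, FreeInverseMonoid.wordVal_of]
    exact FreeInverseMonoid.isSigmaGreatest_red w
  · rw [hmaxi]
    exact FInverseMonoid.isSigmaGreatest_maxi (φ s)
  · rw [FreeInverseMonoid.wordVal_of]
    exact ⟨rfl, rfl⟩
  · rw [MulEquiv.trans_apply, hof]
    refine ⟨?_, rfl⟩
    change CayleySubgraph.pathSpan FreeGroup.of 1 [(x, true)] = _
    rw [← CayleySubgraph.pathSpan_singleton]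
    -- A single edge is connected, so taking its closure changes nothing.
    exact ((redClosure_isClosed_iff.2 (CayleySubgraph.pathSpan_connected _ _)).closure_eq).symm
  · rw [MulEquiv.trans_apply, hinv, FreeInverseMonoid.munnEquiv_inv, MulEquiv.trans_apply]
  · rw [MulEquiv.trans_apply, hmaxi, MulEquiv.trans_apply]
    induction φ s using FreeInverseMonoid.ind with
    | h w =>
      rw [FreeInverseMonoid.maxi_mk, FreeInverseMonoid.munnEquiv_mk, ClosureMonoid.ofWord_red,
        FreeInverseMonoid.munnEquiv_mk]
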